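/- Let $f$ be a field of characteristic $0$ and, for $\lambda,\mu\in f$, let $F_{\lambda\mu}=f[[t]]\,t^\mu(dt)^{-\lambda}$, with coordinates $x_k$ ($k\ge 0$) given by $x_k\bigl(\sum_i a_i t^{i+\mu}(dt)^{-\lambda}\bigr)=a_k$. Let $G_n$ be the group of automorphisms $g$ of $f[[t]]$ over $f$ with $g(t)=t+o(t^n)$, acting on $F_{\lambda\mu}$ (for $n\ge1$) by $$g\cdot\bigl(h\,t^\mu(dt)^{-\lambda}\bigr)=g(h)\,\Bigl(\frac{g(t)}{t}\Bigr)^{\mu}\Bigl(\frac{dg(t)}{dt}\Bigr)^{-\lambda}\,t^\mu(dt)^{-\lambda},$$ where powers of series with constant term $1$ are given by the binomial series. For nonnegative integers $i$ we regard $F_{\lambda,\mu+i}\subseteq F_{\lambda\mu}$. An orbit in $F_{\lambda\mu}$ is called in general position if $x_0\ne 0$ on it when $(\lambda,\mu)\neq(0,0)$, and if $x_1\neq0$ on it when $\lambda=\mu=0$. For $\lambda\neq0$ and integers $m\ge 0$, $k\ge1$ the polynomials $P_{mk}^{(-1/\lambda)}$ are defined by $$\sum_{k=1}^{\infty} P_{mk}^{(-1/\lambda)}(x_0,\dots,x_{m+k})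 z^k=\frac{\bigl(\sum_{i=0}^{\infty}x_ix_0^{i-1}z^i\bigr)^{-1/\lambda}-\bigl(\sum_{i=0}^{m}x_ix_0^{i-1}z^i\bigr)^{-1/\lambda}}{x_0^mz^m}.$$ Let $m$ be a non-negative integer and $\lambda,\mu\in f$. (1) If $\mu\neq(m+k+1)\lambda$ for every positive integer $k$, then the orbits in general position of $G_{m+1}$ in $F_{\lambda\mu}$ are parametrized bijectively by $m+1$ numbers $c_0\in f^\ast$, $c_1,\dots,c_m\in f$: they are the affine planes of codimension $m+1$ given by the equations $x_0=c_0,\dots,x_m=c_m$. (2) If $\lambda\neq0$ and $\mu=(m+k+1)\lambda$ for a positive integer $k$, then the orbits in general position of $G_{m+1}$ in $F_{\lambda\mu}$ are parametrized bijectively by $m+2$ numbers $c_0\in f^\ast$, $c_1,\dots,c_{m+1}\in f$: they are affine varieties of codimension $m+2$, given by the equations $x_0=c_0,\dots,x_m=c_m$, $P_{mk}^{(-1/\lambda)}(x_0,\dots,x_{m+k})=c_{m+1}$ if $-1/\lambda\neq n$ for every positive integer $n<k$, or by $x_0=c_0,\dots,x_m=c_m$, $P_{mk}^{(-1/\lambda)}(x_0,\dots,x_{m+k})/x_0^{k-n}=c_{m+1}$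 if $-1/\lambda=n$ for a positive integer $n$. (3) Each orbit in general position of $G_{m+1}$ in $F_{\lambda\mu}$ is an orbit of $G_{m+1}$ in $F_{\lambda,\mu-i}$ for each nonnegative integer $i$. (4) Unless $\lambda=0$ and $\mu$ is a non-positive integer, each orbit of $G_{m+1}$ in $F_{\lambda\mu}$ other than $\{0\}$ is an orbit in general position of $G_{m+1}$ in $F_{\lambda,\mu+i}$ for some nonnegative integer $i$. (5) If $\lambda=0$ and $\mu$ is a non-positive integer, then the sets $c+\mathcal O$, with $c\in f^\ast$ and $\mathcal O$ an orbit in general position of $G_{m+1}$ in $F_{0i}$ for a positive integer $i$, and the one-point sets $\{c\}$ with $c\in f^\ast$, are also orbits of $G_{m+1}$ in $F_{0\mu}$. None of these is an orbit in general position in $F_{0,\mu+i}$ for a nonnegative integer $i$ with $\mu+i\neq0$, and every orbit in $F_{0\mu}$ other than $\{0\}$ is either one of these or an orbit in general position in $F_{0,\mu+i}$ for some nonnegative integer $i$ with $\mu+i\ne0$. -/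

import Mathlib

open scoped PowerSeries

noncomputable section

namespace TensorFields

open PowerSeries

/-- The power `u ^ α = ∑ⱼ (α choose j) (u - 1) ^ j` of a formal power series `u` with constant
coefficient `1`, for an exponent `α` in a field `K` of characteristic zero; the coefficients of `u`
lie in a commutative `K`-algebra `R`. -/
def binomialPow {K : Type*} [Field K] [CharZero K] {R : Type*} [CommRing R] [Algebra K R]
    (u : R⟦X⟧) (α : K) : R⟦X⟧ :=
  (binomialSeries R α).subst (u - 1)

section Group

variable {K : Type*} [Field K]

/-- An automorphism of `K⟦X⟧` over `K` preserves the maximal ideal. -/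
theorem X_dvd_apply_X (g : K⟦X⟧ ≃ₐ[K] K⟦X⟧) : (X : K⟦X⟧) ∣ g X := by
  rw [X_dvd_iff]
  by_contra h
  have hu : IsUnit (g X) := isUnit_iff_constantCoeff.2 (isUnit_iff_ne_zero.2 h)
  have hx : IsUnit (X : K⟦X⟧) := by simpa using hu.map g.symm
  exact X_prime.not_isUnit hx

theorem X_pow_dvd_apply (g : K⟦X⟧ ≃ₐ[K] K⟦X⟧) {n : ℕ} {h : K⟦X⟧} (hn : X ^ n ∣ h) :
    X ^ n ∣ g h := by
  obtain ⟨r, rfl⟩ := hn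
  rw [map_mul, map_pow]
  exact Dvd.dvd.mul_right (pow_dvd_pow_of_dvd (X_dvd_apply_X g) n) _

variable (K) in
/-- The group `G_n` of the automorphisms `g` of the formal line over `K` with
`g(t) = t + o(t^n)`. -/
def G (n : ℕ) : Subgroup (K⟦X⟧ ≃ₐ[K] K⟦X⟧) where
  carrier := {g | X ^ (n + 1) ∣ g X - X}
  one_mem' := by simp
  mul_mem' := by
    intro a b ha hb
    have h := dvd_add (X_pow_dvd_apply a hb) ha
    simpa using h
  inv_mem' := by
    intro a ha
    have h := X_pow_dvd_apply a⁻¹ ha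
    have e : a⁻¹ (a X) = X := by
      rw [← AlgEquiv.mul_apply, inv_mul_cancel, AlgEquiv.one_apply]
    rw [map_sub, e] at h
    simpa using (dvd_neg.2 h)

end Group

variable {K : Type*} [Field K] [CharZero K]

/-- The action of an automorphism `g` with `g(t) = t + o(t)` on the space
`F_{λμ} = K⟦t⟧ t^μ (dt)^{-λ}`. The element `h t^μ (dt)^{-λ}` is represented by the series `h`, so
that the coordinate `x_i` is the `i`-th coefficient of `h`, and
`g · (h t^μ (dt)^{-λ}) = g(h) (g(t) / t)^μ (d g(t) / dt)^{-λ} · t^μ (dt)^{-λ}`.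
The series `g(t) / t` has `i`-th coefficient the `(i + 1)`-st coefficient of `g(t)`. -/
def act (lam mu : K) (g : K⟦X⟧ ≃ₐ[K] K⟦X⟧) (h : K⟦X⟧) : K⟦X⟧ :=
  g h * binomialPow (PowerSeries.mk fun i => coeff (i + 1) (g X)) mu *
    binomialPow (derivative K (g X)) (-lam)

/-- The orbit of `h ∈ F_{λμ}` under the group `G_{m+1}`. -/
def orbit (m : ℕ) (lam mu : K) (h : K⟦X⟧) : Set K⟦X⟧ :=
  {h' | ∃ g ∈ G K (m + 1), h' = act lam mu g h}

/-- `O` is an orbit of `G_{m+1}` in `F_{λμ}`. -/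
def IsOrbit (m : ℕ) (lam mu : K) (O : Set K⟦X⟧) : Prop :=
  ∃ h, O = orbit m lam mu h

/-- `h ∈ F_{λμ}` is in general position if the coordinate `x_0` does not vanish at `h`; in the
space `F_{00}` of functions, where the basis vector `e_0 = 1` is fixed by the group and splits off
as a trivial summand, the condition is that `x_1` does not vanish at `h`. -/
def InGeneralPosition (lam mu : K) (h : K⟦X⟧) : Prop :=
  (¬(lam = 0 ∧ mu = 0) ∧ coeff 0 h ≠ 0) ∨ ((lam = 0 ∧ mu = 0) ∧ coeff 1 h ≠ 0)

/-- `O` is an orbit in general position of `G_{m+1}` in `F_{λμ}`. -/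
def IsGeneralOrbit (m : ℕ) (lam mu : K) (O : Set K⟦X⟧) : Prop :=
  ∃ h, InGeneralPosition lam mu h ∧ O = orbit m lam mu h

/-- A subset of `F_{λ,μ+i}` as a subset of `F_{λμ}`, by the inclusion
`t^{μ+i} K⟦t⟧ (dt)^{-λ} ⊆ t^μ K⟦t⟧ (dt)^{-λ}`. -/
def incl (i : ℕ) (O : Set K⟦X⟧) : Set K⟦X⟧ :=
  (fun h : K⟦X⟧ => X ^ i * h) '' O

/-- The element `c · t^j t^{-j}` of `F_{0,-j}`, that is, the constant function `c`. -/
def constFun (j : ℕ) (c : K) : K⟦X⟧ := PowerSeries.C c * X ^ j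

/-- For a subset `O` of `F_{0i}`, the set `c + O` as a subset of `F_{0,-j}`. -/
def constAdd (j i : ℕ) (c : K) (O : Set K⟦X⟧) : Set K⟦X⟧ :=
  (fun h => constFun j c + h) '' incl (i + j) O

variable (K) in
/-- The series `∑_{i ≥ 0} x_i x_0^{i-1} z^i = 1 + ∑_{i ≥ 1} x_i x_0^{i-1} z^i` in `z` over the
polynomial ring `K[x_0, x_1, …]`. -/
def genSeries : (MvPolynomial ℕ K)⟦X⟧ :=
  PowerSeries.mk fun i => if i = 0 then 1 else MvPolynomial.X i * MvPolynomial.X 0 ^ (i - 1)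

/-- The polynomial `P_{mk}^{(α)} ∈ K[x_0, x_1, …]`, for `k ≥ 1`: the coefficient of `z^k` in
`((∑_{i ≥ 0} x_i x_0^{i-1} z^i)^α - (∑_{i = 0}^m x_i x_0^{i-1} z^i)^α) / (x_0^m z^m)`. -/
def P (m k : ℕ) (α : K) : MvPolynomial ℕ K :=
  MvPolynomial.divMonomial
    (coeff (m + k) (binomialPow (genSeries K) α -
      binomialPow (trunc (m + 1) (genSeries K) : (MvPolynomial ℕ K)⟦X⟧) α))
    (Finsupp.single 0 m)

/-- The value of a polynomial in the coordinates `x_0, x_1, …` at a point `h`. -/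
def evalAt (h : K⟦X⟧) (p : MvPolynomial ℕ K) : K :=
  MvPolynomial.eval (fun i => coeff i h) p

/-- The set given by the equations `x_0 = c_0, …, x_m = c_m`. -/
def coordPlane (m : ℕ) (c : Fin (m + 1) → K) : Set K⟦X⟧ :=
  {h | ∀ i : Fin (m + 1), coeff (i : ℕ) h = c i}

/-- The set given by the equations `x_0 = c_0, …, x_m = c_m, P_{mk}^{(α)} = c_{m+1}`. -/
def resonantVariety (m k : ℕ) (α : K) (c : Fin (m + 2) → K) : Set K⟦X⟧ :=
  {h | (∀ i : Fin (m + 1), coeff (i : ℕ) h = c i.castSucc) ∧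
    evalAt h (P m k α) = c (Fin.last (m + 1))}

/-- The set given by the equations
`x_0 = c_0, …, x_m = c_m, P_{mk}^{(α)} / x_0^{k-n} = c_{m+1}`. -/
def resonantVarietyDiv (m k n : ℕ) (α : K) (c : Fin (m + 2) → K) : Set K⟦X⟧ :=
  {h | (∀ i : Fin (m + 1), coeff (i : ℕ) h = c i.castSucc) ∧
    evalAt h (P m k α) / coeff 0 h ^ ((k : ℤ) - (n : ℤ)) = c (Fin.last (m + 1))}

/-- `S` is an affine plane of codimension `d`. -/
def IsAffinePlaneOfCodim (S : Set K⟦X⟧) (d : ℕ) : Prop :=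
  ∃ A : AffineSubspace K K⟦X⟧, (A : Set K⟦X⟧) = S ∧ S.Nonempty ∧
    Module.finrank K (K⟦X⟧ ⧸ A.direction) = d

/-- The first `N` coordinates `x_0, …, x_{N-1}` of a point. -/
def firstCoords (N : ℕ) (h : K⟦X⟧) : Fin N → K := fun i => coeff (i : ℕ) h

/-- `S` is an (irreducible) affine variety of codimension `d`: it is the preimage, under the
projection to some `N` first coordinates, of an irreducible algebraic subset `V` of `K^N` of
dimension `N - d`. The dimension of `V` is the Krull dimension of its coordinate ring. -/
def IsAffineVarietyOfCodim (S : Set K⟦X⟧) (d : ℕ) : Prop :=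
  ∃ (N : ℕ) (V : Set (Fin N → K)),
    S = {h | firstCoords N h ∈ V} ∧
    (∃ I : Ideal (MvPolynomial (Fin N) K), V = MvPolynomial.zeroLocus K I) ∧
    (MvPolynomial.vanishingIdeal K V).IsPrime ∧
    ringKrullDim (MvPolynomial (Fin N) K ⧸ MvPolynomial.vanishingIdeal K V) + (d : WithBot ℕ∞) =
      (N : WithBot ℕ∞)

end TensorFields

end

/-! An element of `G K (m + 1)` is a substitution `t ↦ φ` with `φ ≡ t` modulo `t^(m+2)`, so it
preserves `x_0, …, x_m`. Changing `φ` by `a t^(n+1)` first affects `φ · h` in degree `n`, where it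
adds `(μ - (n+1)λ) x_0 a` (`coeff_substAct_sub`). If this factor is nonzero for all `n > m`, then `φ
· h = h'` is solved degree by degree for every `h'` with the same `x_0, …, x_m`.

If `λ ≠ 0` and `μ = (m+k+1)λ`, the only obstruction is in degree `n = m + k`. There the power `-1/λ`
of the tensor field is, up to a constant, the differential form `(h/x_0)^(-1/λ) t^(-n-1) dt`, and
its residue is invariant (`residue_substAct`). With the lower coordinates fixed, the residue is
affine in `x_n` with nonzero slope, so it is the only extra invariant (`mem_orbit_iff_of_resonant`).
The polynomial `P` carries the same information: `x_0^m P` is `x_0^(m+k)` times the residue minus a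
function of `x_0, …, x_m` (`evalAt_P`). Solving for `x_n` exhibits an orbit as a graph.

Multiplication by `t^i` is equivariant from `F_{λ,μ+i}` to `F_{λμ}`, and a nonzero series is `t^i`
times one with `x_0 ≠ 0`. This settles the remaining claims except where the latter lands in
`F_{00}`; there the constants are fixed by the group and split off. -/

noncomputable section

namespace TensorFields

open PowerSeries

/-! ### Dependence of a composite series on the inner series. -/

section Substitution

variable {R : Type*} [CommRing R]

theorem hasSubst_of_X_dvd {v : R⟦X⟧} (hv : X ∣ v) : HasSubst v :=
  HasSubst.of_constantCoeff_zero' (X_dvd_iff.1 hv)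

/-- Since `v` and `v'` have no constant term, `f` can be replaced by its truncation modulo `X^n`;
for a polynomial `p`, the difference `p(v') - p(v)` is a multiple of `v' - v`. -/
theorem X_pow_dvd_subst_sub_subst {v v' : R⟦X⟧} (hv : X ∣ v) (hv' : X ∣ v') {n : ℕ}
    (h : X ^ n ∣ v' - v) (f : R⟦X⟧) : X ^ n ∣ f.subst v' - f.subst v := by
  have key : ∀ w : R⟦X⟧, X ∣ w →
      X ^ n ∣ f.subst w - Polynomial.aeval w (trunc n f) := by
    intro w hw
    have e := congrArg (PowerSeries.subst w) (f.eq_X_pow_mul_shift_add_trunc n)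
    have hs := hasSubst_of_X_dvd hw
    rw [subst_add hs, subst_mul hs, subst_pow hs, subst_X hs, subst_coe hs] at e
    rw [e, add_sub_cancel_right]
    exact (pow_dvd_pow_of_dvd hw n).mul_right _
  have h2 : X ^ n ∣ Polynomial.aeval v' (trunc n f) - Polynomial.aeval v (trunc n f) :=
    by
    simp only [Polynomial.aeval_def, ← Polynomial.eval_map]
    exact h.trans (Polynomial.sub_dvd_eval_sub _ _ _)
  have := dvd_add (dvd_sub (key v' hv') (key v hv)) h2
  convert this using 1
  ring

/-- In the terms of order at least two, `v' - v` is always accompanied by a factor `v` or `v'`, or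
by a sum of these, which supplies one more power of `X`. -/
theorem X_pow_dvd_subst_linear {v v' : R⟦X⟧} (hv : X ∣ v) (hv' : X ∣ v') {n : ℕ}
    (h : X ^ n ∣ v' - v) (f : R⟦X⟧) :
    X ^ (n + 1) ∣ f.subst v' - f.subst v - PowerSeries.C (coeff 1 f) * (v' - v) := by
  obtain ⟨r, hr⟩ : X ∣ (PowerSeries.mk fun i => coeff (i + 1) f) - PowerSeries.C (coeff 1 f) := by
    rw [X_dvd_iff]; simp
  have e : f = PowerSeries.C (constantCoeff f) + X * (PowerSeries.C (coeff 1 f) + X * r) := by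
    rw [← hr]
    nth_rw 1 [eq_X_mul_shift_add_const f]
    ring
  have key : ∀ w : R⟦X⟧, X ∣ w → f.subst w = PowerSeries.C (constantCoeff f) +
      w * (PowerSeries.C (coeff 1 f) + w * r.subst w) := by
    intro w hw
    have hs := hasSubst_of_X_dvd hw
    have e' := congrArg (PowerSeries.subst w) e
    rw [subst_add hs, subst_mul hs, subst_add hs, subst_mul hs, subst_X hs, subst_C, subst_C] at e'
    exact e'
  rw [key v' hv', key v hv]
  have h1 := X_pow_dvd_subst_sub_subst hv hv' h r
  have h2 : X ^ (n + 1) ∣ (v' - v) * (v' + v) := by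
    rw [pow_succ]; exact mul_dvd_mul h (dvd_add hv' hv)
  have h3 : X ^ (n + 1) ∣ (r.subst v' - r.subst v) * v := by
    rw [pow_succ]; exact mul_dvd_mul h1 hv
  have := dvd_add (h2.mul_right (r.subst v')) (h3.mul_right v)
  convert this using 1
  ring

end Substitution

/-! ### Binomial powers over a `K`-algebra and their differential equation. -/

section BinomialPow

variable {K : Type*} [Field K] [CharZero K] {R : Type*} [CommRing R] [Algebra K R]

theorem X_dvd_sub_one {u : R⟦X⟧} (hu : constantCoeff u = 1) : X ∣ u - 1 := by
  rw [X_dvd_iff]; simp [hu]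

theorem hasSubst_sub_one {u : R⟦X⟧} (hu : constantCoeff u = 1) : HasSubst (u - 1) :=
  hasSubst_of_X_dvd (X_dvd_sub_one hu)

theorem constantCoeff_subst_of_X_dvd {v : R⟦X⟧} (hv : X ∣ v) (f : R⟦X⟧) :
    constantCoeff (f.subst v) = constantCoeff f := by
  have h := X_pow_dvd_subst_sub_subst (dvd_zero X) hv (n := 1) (by simpa using hv) f
  rw [pow_one, X_dvd_iff, map_sub, sub_eq_zero] at h
  rw [h, subst_zero_eq_C_constantCoeff]
  exact constantCoeff_C _

theorem constantCoeff_binomialPow {u : R⟦X⟧} (hu : constantCoeff u = 1) (α : K) :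
    constantCoeff (binomialPow u α) = 1 := by
  rw [binomialPow, constantCoeff_subst_of_X_dvd (X_dvd_sub_one hu)]
  exact binomialSeries_constantCoeff _

theorem map_binomialPow {S : Type*} [CommRing S] [Algebra K S] (f : R →ₐ[K] S) {u : R⟦X⟧}
    (hu : constantCoeff u = 1) (α : K) :
    PowerSeries.map (f : R →+* S) (binomialPow u α) =
      binomialPow (PowerSeries.map (f : R →+* S) u) α := by
  rw [binomialPow, binomialPow]
  have : PowerSeries.map (f : R →+* S) (binomialSeries R α) = binomialSeries S α := by
    ext n; simp
  rw [← this, ← map_one (PowerSeries.map (f : R →+* S)), ← map_sub]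
  exact PowerSeries.map_subst (hasSubst_sub_one hu) _

theorem binomialPow_add {u : R⟦X⟧} (hu : constantCoeff u = 1) (α β : K) :
    binomialPow u (α + β) = binomialPow u α * binomialPow u β := by
  rw [binomialPow, binomialSeries_add, subst_mul (hasSubst_sub_one hu)]; rfl

theorem binomialPow_natCast {u : R⟦X⟧} (hu : constantCoeff u = 1) (n : ℕ) :
    binomialPow u (n : K) = u ^ n := by
  have hs := hasSubst_sub_one hu
  rw [binomialPow, binomialSeries_nat, subst_pow hs, subst_add hs, subst_X hs,
    ← map_one (PowerSeries.C (R := R)), subst_C]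
  congr 1
  exact add_sub_cancel _ _

theorem binomialPow_zero {u : R⟦X⟧} (hu : constantCoeff u = 1) :
    binomialPow u (0 : K) = 1 := by
  simpa using binomialPow_natCast (K := K) hu 0

theorem binomialPow_one {u : R⟦X⟧} (hu : constantCoeff u = 1) :
    binomialPow u (1 : K) = u := by
  simpa using binomialPow_natCast (K := K) hu 1

theorem binomialPow_mul_neg {u : R⟦X⟧} (hu : constantCoeff u = 1) (α : K) :
    binomialPow u α * binomialPow u (-α) = 1 := by
  rw [← binomialPow_add hu, add_neg_cancel, binomialPow_zero hu]

theorem one_binomialPow (α : K) : binomialPow (1 : R⟦X⟧) α = 1 := by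
  rw [binomialPow, sub_self, subst_zero_eq_C_constantCoeff, binomialSeries_constantCoeff]
  exact map_one (PowerSeries.C (R := R))

theorem X_pow_dvd_binomialPow_linear {u u' : R⟦X⟧} (hu : constantCoeff u = 1)
    (hu' : constantCoeff u' = 1) {n : ℕ} (h : X ^ n ∣ u' - u) (α : K) :
    X ^ (n + 1) ∣ binomialPow u' α - binomialPow u α -
      PowerSeries.C (algebraMap K R α) * (u' - u) := by
  have := X_pow_dvd_subst_linear (X_dvd_sub_one hu) (X_dvd_sub_one hu') (n := n)
    (by simpa using h) (binomialSeries R α)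
  simpa [Algebra.algebraMap_eq_smul_one, binomialPow] using this

theorem X_pow_dvd_binomialPow_sub {u u' : R⟦X⟧} (hu : constantCoeff u = 1)
    (hu' : constantCoeff u' = 1) {n : ℕ} (h : X ^ n ∣ u' - u) (α : K) :
    X ^ n ∣ binomialPow u' α - binomialPow u α :=
  X_pow_dvd_subst_sub_subst (X_dvd_sub_one hu) (X_dvd_sub_one hu') (by simpa using h) _

/-- Coefficientwise this is `(n+1) C(α,n+1) + n C(α,n) = α C(α,n)`, the recursion of the descending
Pochhammer polynomials. -/
theorem one_add_X_mul_derivative_binomialSeries (α : K) :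
    (1 + X) * derivative R (binomialSeries R α) =
      PowerSeries.C (algebraMap K R α) * binomialSeries R α := by
  have hc : ∀ n : ℕ, ((n : K) + 1) * Ring.choose α (n + 1) + n * Ring.choose α n =
      α * Ring.choose α n := by
    intro n
    have h0 := Ring.descPochhammer_eq_factorial_smul_choose α n
    have h1 := Ring.descPochhammer_eq_factorial_smul_choose α (n + 1)
    rw [descPochhammer_succ_right, Polynomial.smeval_mul, h0] at h1
    have : (n.factorial : K) ≠ 0 := by exact_mod_cast n.factorial_ne_zero
    apply mul_left_cancel₀ this
    simp [Nat.factorial_succ, Polynomial.smeval_sub, Polynomial.smeval_natCast] at h1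
    linear_combination -h1
  ext n
  have := congrArg (algebraMap K R) (hc n)
  rcases n with _ | n
  · rw [add_mul, one_mul, map_add, coeff_zero_X_mul, coeff_derivative]
    simp [← Algebra.algebraMap_eq_smul_one]
  · simp [add_mul, coeff_succ_X_mul, coeff_derivative, ← Algebra.algebraMap_eq_smul_one] at this ⊢
    linear_combination this

theorem mul_derivative_binomialPow {u : R⟦X⟧} (hu : constantCoeff u = 1) (α : K) :
    u * derivative R (binomialPow u α) =
      PowerSeries.C (algebraMap K R α) * derivative R u * binomialPow u α := by
  have hs := hasSubst_sub_one hu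
  have h := congrArg (PowerSeries.subst (u - 1))
    (one_add_X_mul_derivative_binomialSeries (R := R) α)
  have h1 : PowerSeries.subst (u - 1) (1 + X : R⟦X⟧) = u := by
    rw [subst_add hs, subst_X hs, ← map_one (PowerSeries.C (R := R)), subst_C]
    exact add_sub_cancel _ _
  rw [subst_mul hs, h1, subst_mul hs, subst_C] at h
  rw [binomialPow, derivative_subst hs, map_sub, derivative_one, sub_zero, ← mul_assoc, h]
  change PowerSeries.C _ * _ * _ = _
  ring

end BinomialPow

/-! ### Power laws for binomial powers, from uniqueness in the differential equation. -/

section Field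

variable {K : Type*} [Field K] [CharZero K]

theorem binomialPow_ne_zero {u : K⟦X⟧} (hu : constantCoeff u = 1) (α : K) :
    binomialPow u α ≠ 0 := by
  intro h
  simpa [h] using constantCoeff_binomialPow hu α

theorem ne_zero_of_constantCoeff_eq_one {u : K⟦X⟧} (hu : constantCoeff u = 1) : u ≠ 0 := by
  rintro rfl; simp at hu

/-- The quotient `f u^(-α)` has derivative zero and constant term one. Multiplicativity in the base
and the law for iterated powers both follow from this criterion. -/
theorem eq_binomialPow_of_mul_derivative {u f : K⟦X⟧} (hu : constantCoeff u = 1)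
    (hf : constantCoeff f = 1) (α : K)
    (h : u * derivative K f = PowerSeries.C α * derivative K u * f) : f = binomialPow u α := by
  have h1 : f * binomialPow u (-α) = 1 := by
    apply derivative.ext
    · apply mul_left_cancel₀ (ne_zero_of_constantCoeff_eq_one hu)
      have h2 := mul_derivative_binomialPow hu (-α)
      rw [Derivation.leibniz, derivative_one]
      simp only [smul_eq_mul, Algebra.algebraMap_self, RingHom.id_apply, map_neg] at h2 ⊢
      linear_combination binomialPow u (-α) * h + f * h2
    · simp [hf, constantCoeff_binomialPow hu]
  calc f = f * (binomialPow u α * binomialPow u (-α)) := by rw [binomialPow_mul_neg hu, mul_one]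
    _ = f * binomialPow u (-α) * binomialPow u α := by ring
    _ = _ := by rw [h1, one_mul]

theorem mul_binomialPow {u w : K⟦X⟧} (hu : constantCoeff u = 1) (hw : constantCoeff w = 1)
    (α : K) : binomialPow (u * w) α = binomialPow u α * binomialPow w α := by
  symm
  apply eq_binomialPow_of_mul_derivative
  · simp [hu, hw]
  · simp [constantCoeff_binomialPow, hu, hw]
  · have h1 := mul_derivative_binomialPow hu α
    have h2 := mul_derivative_binomialPow hw α
    simp only [Derivation.leibniz, smul_eq_mul, Algebra.algebraMap_self, RingHom.id_apply]
      at h1 h2 ⊢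
    linear_combination w * binomialPow w α * h1 + u * binomialPow u α * h2

theorem binomialPow_binomialPow {u : K⟦X⟧} (hu : constantCoeff u = 1) (α β : K) :
    binomialPow (binomialPow u α) β = binomialPow u (α * β) := by
  apply eq_binomialPow_of_mul_derivative hu
  · simp [constantCoeff_binomialPow, hu]
  · have h1 := mul_derivative_binomialPow hu α
    have h2 := mul_derivative_binomialPow (constantCoeff_binomialPow hu α) β
    apply mul_left_cancel₀ (binomialPow_ne_zero hu α)
    simp only [map_mul, Algebra.algebraMap_self, RingHom.id_apply] at h1 h2 ⊢
    linear_combination u * h2 + PowerSeries.C β * binomialPow (binomialPow u α) β * h1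

theorem subst_binomialPow {u φ : K⟦X⟧} (hu : constantCoeff u = 1) (hφ : X ∣ φ) (α : K) :
    (binomialPow u α).subst φ = binomialPow (u.subst φ) α := by
  have hs := hasSubst_of_X_dvd hφ
  rw [binomialPow, subst_comp_subst_apply (hasSubst_sub_one hu) hs, subst_sub hs,
    ← map_one (PowerSeries.C (R := K)), subst_C]
  rfl

theorem rescale_binomialPow {u : K⟦X⟧} (hu : constantCoeff u = 1) (a α : K) :
    rescale a (binomialPow u α) = binomialPow (rescale a u) α := by
  simp only [rescale_eq_subst]
  exact subst_binomialPow hu (by rw [smul_eq_C_mul]; exact dvd_mul_left _ _) α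

end Field

/-! ### Successive approximation in the `X`-adic topology. -/

section Generalities

variable {R : Type*} [CommRing R]

theorem eq_of_forall_X_pow_dvd_sub {f g : R⟦X⟧} (h : ∀ n : ℕ, X ^ n ∣ f - g) : f = g := by
  ext n
  have := X_pow_dvd_iff.1 (h (n + 1)) n (Nat.lt_succ_self n)
  rwa [map_sub, sub_eq_zero] at this

theorem X_pow_dvd_sub_iff {f g : R⟦X⟧} {n : ℕ} :
    X ^ n ∣ f - g ↔ ∀ i < n, coeff i f = coeff i g := by
  simp [X_pow_dvd_iff, sub_eq_zero]

theorem X_pow_succ_dvd_iff {f : R⟦X⟧} {n : ℕ} :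
    X ^ (n + 1) ∣ f ↔ X ^ n ∣ f ∧ coeff n f = 0 := by
  simp only [X_pow_dvd_iff]
  constructor
  · exact fun h => ⟨fun m hm => h m (by omega), h n (by omega)⟩
  · rintro ⟨h1, h2⟩ m hm
    rcases Nat.lt_succ_iff_lt_or_eq.1 hm with h | rfl
    exacts [h1 m h, h2]

/-- An equation `F φ = T` in power series can be solved by choosing the coefficients of `φ` one
after another. -/
theorem exists_eq_of_step (F : R⟦X⟧ → R⟦X⟧) (φ₀ T : R⟦X⟧) (n₀ s : ℕ) (h₀ : X ^ n₀ ∣ F φ₀ - T)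
    (cont : ∀ n φ φ', n₀ ≤ n → X ^ (n₀ + s) ∣ φ - φ₀ → X ^ (n₀ + s) ∣ φ' - φ₀ →
      X ^ (n + s) ∣ φ' - φ → X ^ n ∣ F φ' - F φ)
    (step : ∀ n φ, n₀ ≤ n → X ^ (n₀ + s) ∣ φ - φ₀ → X ^ n ∣ F φ - T →
      ∃ a : R, X ^ (n + 1) ∣ F (φ + C a * X ^ (n + s)) - T) :
    ∃ φ, X ^ (n₀ + s) ∣ φ - φ₀ ∧ F φ = T := by
  -- Stage `j` holds solutions modulo `X^(n₀+j)`. The shift `s` records that degree `n + s` of `φ`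
  -- controls degree `n` of `F φ`.
  let Good (j : ℕ) := {φ : R⟦X⟧ // X ^ (n₀ + s) ∣ φ - φ₀ ∧ X ^ (n₀ + j) ∣ F φ - T}
  have next : ∀ j (φ : Good j), ∃ φ' : Good (j + 1), X ^ (n₀ + j + s) ∣ φ'.1 - φ.1 := by
    rintro j ⟨φ, h1, h2⟩
    obtain ⟨a, ha⟩ := step (n₀ + j) φ (by omega) h1 h2
    refine ⟨⟨φ + C a * X ^ (n₀ + j + s), ?_, by rwa [← add_assoc]⟩, by simp⟩
    rw [add_sub_right_comm]
    exact dvd_add h1 (dvd_mul_of_dvd_right (pow_dvd_pow _ (by omega)) _)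
  choose nx hnx using next
  let seq : (j : ℕ) → Good j := fun j =>
    Nat.rec (motive := Good) ⟨φ₀, by simp, by simpa using h₀⟩ nx j
  have hstep : ∀ j, X ^ (n₀ + j + s) ∣ (seq (j + 1)).1 - (seq j).1 := fun j => hnx j (seq j)
  have hcauchy : ∀ j i, X ^ (n₀ + j + s) ∣ (seq (j + i)).1 - (seq j).1 := by
    intro j i
    induction i with
    | zero => simp
    | succ i ih =>
      have h1 := (pow_dvd_pow X (show n₀ + j + s ≤ n₀ + (j + i) + s by omega)).trans
        (hstep (j + i))
      have := dvd_add h1 ih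
      rwa [sub_add_sub_cancel] at this
  -- The limit: the coefficient of degree `i` no longer changes from stage `i + 1` on.
  let φ : R⟦X⟧ := PowerSeries.mk fun i => coeff i (seq (i + 1)).1
  have hφ : ∀ j, X ^ (n₀ + j + s) ∣ φ - (seq j).1 := by
    intro j
    rw [X_pow_dvd_sub_iff]
    intro i hi
    rw [coeff_mk]
    rcases le_total j (i + 1) with h | h
    · obtain ⟨d, hd⟩ := Nat.exists_eq_add_of_le h
      rw [hd]
      exact X_pow_dvd_sub_iff.1 (hcauchy j d) i hi
    · obtain ⟨d, hd⟩ := Nat.exists_eq_add_of_le h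
      rw [hd]
      exact (X_pow_dvd_sub_iff.1 (hcauchy (i + 1) d) i (by omega)).symm
  have h0 : X ^ (n₀ + s) ∣ φ - φ₀ := hφ 0
  refine ⟨φ, h0, eq_of_forall_X_pow_dvd_sub fun n => ?_⟩
  have h1 := cont (n₀ + n) _ _ (by omega) (seq n).2.1 h0 (hφ n)
  have := dvd_add h1 (seq n).2.2
  rw [sub_add_sub_cancel] at this
  exact (pow_dvd_pow X (by omega)).trans this

end Generalities

/-! ### Automorphisms of the formal line as substitutions. -/

section Automorphisms

variable {K : Type*} [Field K]

/-- Continuity of `g` is automatic, because `g` preserves the maximal ideal. Both sides agree on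
polynomials, hence modulo every `X^n`. -/
theorem apply_eq_subst (g : K⟦X⟧ ≃ₐ[K] K⟦X⟧) (h : K⟦X⟧) : g h = h.subst (g X) := by
  have hg := X_dvd_apply_X g
  have hs := hasSubst_of_X_dvd hg
  refine eq_of_forall_X_pow_dvd_sub fun n => ?_
  have e := h.eq_X_pow_mul_shift_add_trunc n
  have hp : g (trunc n h : K⟦X⟧) = PowerSeries.subst (g X) (trunc n h : K⟦X⟧) := by
    rw [subst_coe hs]
    have h1 : ((trunc n h : Polynomial K) : K⟦X⟧) = Polynomial.aeval X (trunc n h) := by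
      rw [← substAlgHom_coe HasSubst.X', coe_substAlgHom]
      exact (X_subst _).symm
    rw [h1]
    exact (Polynomial.aeval_algHom_apply (g : K⟦X⟧ →ₐ[K] K⟦X⟧) X (trunc n h)).symm
  have e1 := congrArg g e
  have e2 := congrArg (PowerSeries.subst (g X)) e
  rw [map_add, map_mul, map_pow, hp] at e1
  rw [subst_add hs, subst_mul hs, subst_pow hs, subst_X hs] at e2
  rw [e1, e2, add_sub_add_right_eq_sub, ← mul_sub]
  exact (pow_dvd_pow_of_dvd hg n).mul_right _

theorem exists_algEquiv_apply_X {φ : K⟦X⟧} (h0 : X ∣ φ) (h1 : coeff 1 φ ≠ 0) :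
    ∃ g : K⟦X⟧ ≃ₐ[K] K⟦X⟧, g X = φ := by
  have hu : IsUnit (coeff 1 φ) := isUnit_iff_ne_zero.2 h1
  have hc : constantCoeff φ = 0 := X_dvd_iff.1 h0
  have hs := hasSubst_of_X_dvd h0
  have ht : HasSubst (φ.substInvOfIsUnit hu) := HasSubst.substInvOfIsUnit φ hu
  refine ⟨AlgEquiv.ofAlgHom (substAlgHom hs) (substAlgHom ht) ?_ ?_, ?_⟩
  · ext1 f
    simp only [AlgHom.comp_apply, AlgHom.id_apply, coe_substAlgHom]
    rw [subst_comp_subst_apply ht hs, subst_substInvOfIsUnit_left φ hc hu]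
    exact X_subst f
  · ext1 f
    simp only [AlgHom.comp_apply, AlgHom.id_apply, coe_substAlgHom]
    rw [subst_comp_subst_apply hs ht, subst_substInvOfIsUnit_right φ hc hu]
    exact X_subst f
  · exact substAlgHom_X hs

theorem X_dvd_of_X_sq_dvd_sub {φ : K⟦X⟧} (hφ : X ^ 2 ∣ φ - X) : X ∣ φ := by
  have h := dvd_add ((dvd_pow_self X two_ne_zero).trans hφ) (dvd_refl X)
  rwa [sub_add_cancel] at h

theorem X_mul_mk_coeff_succ {φ : K⟦X⟧} (hφ : X ∣ φ) :
    X * (PowerSeries.mk fun i => coeff (i + 1) φ) = φ := by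
  conv_rhs => rw [eq_X_mul_shift_add_const φ, X_dvd_iff.1 hφ, map_zero, add_zero]

theorem constantCoeff_mk_coeff_succ {φ : K⟦X⟧} (hφ : X ^ 2 ∣ φ - X) :
    constantCoeff (PowerSeries.mk fun i => coeff (i + 1) φ) = 1 := by
  rw [← coeff_zero_eq_constantCoeff_apply, coeff_mk, X_pow_dvd_sub_iff.1 hφ 1 (by omega)]
  simp

theorem X_pow_dvd_derivative_sub {φ φ' : K⟦X⟧} {n : ℕ} (h : X ^ (n + 1) ∣ φ' - φ) :
    X ^ n ∣ derivative K φ' - derivative K φ := by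
  rw [X_pow_dvd_sub_iff] at h ⊢
  intro i hi
  rw [coeff_derivative, coeff_derivative, h (i + 1) (by omega)]

theorem X_pow_dvd_mk_coeff_succ_sub {φ φ' : K⟦X⟧} {n : ℕ} (h : X ^ (n + 1) ∣ φ' - φ) :
    X ^ n ∣ (PowerSeries.mk fun i => coeff (i + 1) φ') -
      (PowerSeries.mk fun i => coeff (i + 1) φ) := by
  rw [X_pow_dvd_sub_iff] at h ⊢
  intro i hi
  rw [coeff_mk, coeff_mk, h (i + 1) (by omega)]

end Automorphisms

/-! ### The action written through the substituted series, and its leading variation. -/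

section Action

variable {K : Type*} [Field K] [CharZero K]

/-- The action of the substitution `t ↦ φ` on `F_{λμ}`. -/
def substAct (lam mu : K) (φ h : K⟦X⟧) : K⟦X⟧ :=
  h.subst φ * binomialPow (PowerSeries.mk fun i => coeff (i + 1) φ) mu *
    binomialPow (derivative K φ) (-lam)

theorem act_eq_substAct (lam mu : K) (g : K⟦X⟧ ≃ₐ[K] K⟦X⟧) (h : K⟦X⟧) :
    act lam mu g h = substAct lam mu (g X) h := by
  rw [act, substAct, apply_eq_subst]

theorem mem_orbit_iff {m : ℕ} {lam mu : K} {h h' : K⟦X⟧} :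
    h' ∈ orbit m lam mu h ↔ ∃ φ : K⟦X⟧, X ^ (m + 2) ∣ φ - X ∧ h' = substAct lam mu φ h := by
  constructor
  · rintro ⟨g, hg, rfl⟩
    exact ⟨g X, hg, act_eq_substAct lam mu g h⟩
  · rintro ⟨φ, hφ, rfl⟩
    have hc := X_pow_dvd_sub_iff.1 hφ
    obtain ⟨g, rfl⟩ := exists_algEquiv_apply_X (φ := φ)
      (by rw [X_dvd_iff, ← coeff_zero_eq_constantCoeff_apply, hc 0 (by omega)]; simp)
      (by rw [hc 1 (by omega)]; simp)
    exact ⟨g, hφ, (act_eq_substAct lam mu g h).symm⟩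

theorem constantCoeff_derivative {φ : K⟦X⟧} (hφ : X ^ 2 ∣ φ - X) :
    constantCoeff (derivative K φ) = 1 := by
  rw [← coeff_zero_eq_constantCoeff_apply, coeff_derivative,
    X_pow_dvd_sub_iff.1 hφ 1 (by omega)]
  simp

theorem coeff_mul_sub_mul {R : Type*} [CommRing R] {n : ℕ} {a a' b b' : R⟦X⟧}
    (ha : X ^ n ∣ a' - a) (hb : X ^ n ∣ b' - b) (hn : 1 ≤ n) :
    coeff n (a' * b' - a * b) =
      coeff n (a' - a) * constantCoeff b + constantCoeff a * coeff n (b' - b) := by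
  obtain ⟨r, hr⟩ := ha
  obtain ⟨s, hs⟩ := hb
  have e : a' * b' - a * b = X ^ n * (r * b + a * s + X ^ n * (r * s)) := by
    linear_combination b' * hr + (a + X ^ n * r) * hs
  rw [e, hr, hs]
  simp only [coeff_X_pow_mul', if_pos le_rfl, Nat.sub_self]
  simp [show n ≠ 0 by omega]

theorem X_pow_dvd_mul_sub_mul {R : Type*} [CommRing R] {n : ℕ} {a a' b b' : R⟦X⟧}
    (ha : X ^ n ∣ a' - a) (hb : X ^ n ∣ b' - b) : X ^ n ∣ a' * b' - a * b := by
  have := dvd_add (ha.mul_right b') (hb.mul_left a)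
  convert this using 1; ring

theorem coeff_binomialPow_sub {R : Type*} [CommRing R] [Algebra K R] {u u' : R⟦X⟧}
    (hu : constantCoeff u = 1) (hu' : constantCoeff u' = 1) {n : ℕ} (h : X ^ n ∣ u' - u) (α : K) :
    coeff n (binomialPow u' α - binomialPow u α) = algebraMap K R α * coeff n (u' - u) := by
  have h1 := (X_pow_succ_dvd_iff.1 (X_pow_dvd_binomialPow_linear hu hu' h α)).2
  rwa [map_sub, coeff_C_mul, sub_eq_zero] at h1

theorem X_pow_dvd_substAct_sub (lam mu : K) (h : K⟦X⟧) {φ φ' : K⟦X⟧} (hφ : X ^ 2 ∣ φ - X)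
    (hφ' : X ^ 2 ∣ φ' - X) {n : ℕ} (hd : X ^ (n + 1) ∣ φ' - φ) :
    X ^ n ∣ substAct lam mu φ' h - substAct lam mu φ h :=
  X_pow_dvd_mul_sub_mul (X_pow_dvd_mul_sub_mul
    ((pow_dvd_pow X n.le_succ).trans (X_pow_dvd_subst_sub_subst (X_dvd_of_X_sq_dvd_sub hφ)
      (X_dvd_of_X_sq_dvd_sub hφ') hd h))
    (X_pow_dvd_binomialPow_sub (constantCoeff_mk_coeff_succ hφ) (constantCoeff_mk_coeff_succ hφ')
      (X_pow_dvd_mk_coeff_succ_sub hd) mu))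
    (X_pow_dvd_binomialPow_sub (constantCoeff_derivative hφ) (constantCoeff_derivative hφ')
      (X_pow_dvd_derivative_sub hd) (-lam))

/-- The leading term of the variation of `φ · h` with `φ`. -/
theorem coeff_substAct_sub (lam mu : K) (h : K⟦X⟧) {φ φ' : K⟦X⟧} (hφ : X ^ 2 ∣ φ - X)
    (hφ' : X ^ 2 ∣ φ' - X) {n : ℕ} (hn : 1 ≤ n) (hd : X ^ (n + 1) ∣ φ' - φ) :
    coeff n (substAct lam mu φ' h - substAct lam mu φ h) =
      (mu - (n + 1 : ℕ) * lam) * coeff 0 h * coeff (n + 1) (φ' - φ) := by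
  have h0 := X_pow_succ_dvd_iff.1 (X_pow_dvd_subst_sub_subst (X_dvd_of_X_sq_dvd_sub hφ)
      (X_dvd_of_X_sq_dvd_sub hφ') hd h)
  have h1 := X_pow_dvd_mk_coeff_succ_sub hd
  have h2 := X_pow_dvd_derivative_sub hd
  have h1' := X_pow_dvd_binomialPow_sub (constantCoeff_mk_coeff_succ hφ)
    (constantCoeff_mk_coeff_succ hφ') h1 mu
  have h2' := X_pow_dvd_binomialPow_sub (constantCoeff_derivative hφ)
    (constantCoeff_derivative hφ') h2 (-lam)
  -- Leibniz rule for the three factors in degree `n`: `h.subst φ` varies only from degree `n + 1`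
  -- on, the power of `φ/t` contributes `μ`, and the power of the derivative contributes `-(n+1)λ`.
  rw [substAct, substAct, coeff_mul_sub_mul (X_pow_dvd_mul_sub_mul h0.1 h1') h2' hn,
    coeff_mul_sub_mul h0.1 h1' hn, h0.2,
    coeff_binomialPow_sub (constantCoeff_mk_coeff_succ hφ) (constantCoeff_mk_coeff_succ hφ') h1,
    coeff_binomialPow_sub (constantCoeff_derivative hφ) (constantCoeff_derivative hφ') h2,
    map_mul, constantCoeff_binomialPow (constantCoeff_mk_coeff_succ hφ),
    constantCoeff_binomialPow (constantCoeff_derivative hφ),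
    constantCoeff_subst_of_X_dvd (X_dvd_of_X_sq_dvd_sub hφ)]
  simp [coeff_derivative]
  ring

theorem substAct_X (lam mu : K) (h : K⟦X⟧) : substAct lam mu X h = h := by
  have h1 : (PowerSeries.mk fun i => coeff (i + 1) (X : K⟦X⟧)) = 1 := by
    ext i; rcases i with _ | i <;> simp [coeff_X, coeff_one]
  rw [substAct, h1, derivative_X, one_binomialPow, one_binomialPow, mul_one, mul_one]
  exact X_subst h

theorem mem_orbit_self (m : ℕ) (lam mu : K) (h : K⟦X⟧) : h ∈ orbit m lam mu h :=
  mem_orbit_iff.2 ⟨X, by simp, (substAct_X lam mu h).symm⟩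

/-- Since `φ^i = t^i (φ/t)^i`, the factor `(φ/t)^i` is absorbed into the exponent `μ`. -/
theorem substAct_X_pow_mul (lam mu : K) (i : ℕ) {φ : K⟦X⟧} (hφ : X ^ 2 ∣ φ - X) (h : K⟦X⟧) :
    substAct lam mu φ (X ^ i * h) = X ^ i * substAct lam (mu + i) φ h := by
  have hd := X_dvd_of_X_sq_dvd_sub hφ
  have hs := hasSubst_of_X_dvd hd
  have hu := constantCoeff_mk_coeff_succ hφ
  rw [substAct, substAct, subst_mul hs, subst_pow hs, subst_X hs, binomialPow_add hu,
    binomialPow_natCast hu]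
  nth_rw 1 [← X_mul_mk_coeff_succ hd]
  ring

theorem substAct_add (lam mu : K) {φ : K⟦X⟧} (hφ : X ^ 2 ∣ φ - X) (h h' : K⟦X⟧) :
    substAct lam mu φ (h + h') = substAct lam mu φ h + substAct lam mu φ h' := by
  rw [substAct, substAct, substAct, subst_add (hasSubst_of_X_dvd (X_dvd_of_X_sq_dvd_sub hφ))]
  ring

theorem substAct_constFun (j : ℕ) (c : K) {φ : K⟦X⟧} (hφ : X ^ 2 ∣ φ - X) :
    substAct 0 (-(j : K)) φ (constFun j c) = constFun j c := by
  rw [constFun, mul_comm, substAct_X_pow_mul _ _ _ hφ, neg_add_cancel, substAct, neg_zero,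
    binomialPow_zero (constantCoeff_mk_coeff_succ hφ),
    binomialPow_zero (constantCoeff_derivative hφ), mul_one, mul_one, subst_C]
  rfl

end Action

theorem constantCoeff_C_inv_mul {K : Type*} [Field K] {h : K⟦X⟧} (h0 : coeff 0 h ≠ 0) :
    constantCoeff (PowerSeries.C (coeff 0 h)⁻¹ * h) = 1 := by
  rw [map_mul, constantCoeff_C, ← coeff_zero_eq_constantCoeff_apply, inv_mul_cancel₀ h0]

/-! ### The residue invariant. -/

section Residue

variable {K : Type*} [Field K] [CharZero K]

/-- The form `φ^(-q-1) dφ` is exact, so it has no residue. Without negative powers: with `u = φ/t`,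
the series `q u^(-q-1) φ'` is `q - t d/dt` applied to `u^(-q)`, and this operator kills the
coefficient of `t^q`. -/
theorem coeff_binomialPow_neg_mul_derivative {φ : K⟦X⟧} (hφ : X ^ 2 ∣ φ - X) {q : ℕ}
    (hq : q ≠ 0) :
    coeff q (binomialPow (PowerSeries.mk fun i => coeff (i + 1) φ) (-((q : K) + 1)) *
      derivative K φ) = 0 := by
  set u : K⟦X⟧ := PowerSeries.mk fun i => coeff (i + 1) φ with hu_def
  have hu : constantCoeff u = 1 := constantCoeff_mk_coeff_succ hφ
  have hXu : X * u = φ := X_mul_mk_coeff_succ (X_dvd_of_X_sq_dvd_sub hφ)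
  have hdφ : derivative K φ = u + X * derivative K u := by
    rw [← hXu, Derivation.leibniz, derivative_X]; simp only [smul_eq_mul]; ring
  have hq' : (q : K) ≠ 0 := Nat.cast_ne_zero.2 hq
  have hmul : binomialPow u (-(q : K)) = binomialPow u (-((q : K) + 1)) * u := by
    conv_rhs => rw [← binomialPow_one (K := K) hu, binomialPow_binomialPow hu, one_mul,
      ← binomialPow_add hu]
    congr 1; ring
  have hder : derivative K (binomialPow u (-(q : K))) =
      PowerSeries.C (-(q : K)) * derivative K u * binomialPow u (-((q : K) + 1)) := by
    apply mul_left_cancel₀ (ne_zero_of_constantCoeff_eq_one hu)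
    rw [mul_derivative_binomialPow hu, Algebra.algebraMap_self, RingHom.id_apply]
    nth_rw 1 [hmul]
    ring
  have e : PowerSeries.C (q : K) * (binomialPow u (-((q : K) + 1)) * derivative K φ) =
      PowerSeries.C (q : K) * binomialPow u (-(q : K)) -
        X * derivative K (binomialPow u (-(q : K))) := by
    rw [hder, hdφ, hmul, map_neg]; ring
  have h := congrArg (coeff q) e
  obtain ⟨r, rfl⟩ := Nat.exists_eq_succ_of_ne_zero hq
  rw [coeff_C_mul, map_sub, coeff_C_mul, coeff_succ_X_mul, coeff_derivative] at h
  apply mul_left_cancel₀ hq'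
  rw [h]
  push_cast
  ring

/-- The residue of the differential form `w t^{-n-1} dt` is invariant under substitutions. -/
theorem coeff_subst_mul_binomialPow_mul_derivative (n : ℕ) {φ : K⟦X⟧} (hφ : X ^ 2 ∣ φ - X)
    (w : K⟦X⟧) :
    coeff n (w.subst φ * binomialPow (PowerSeries.mk fun i => coeff (i + 1) φ) (-((n : K) + 1)) *
      derivative K φ) = coeff n w := by
  set u : K⟦X⟧ := PowerSeries.mk fun i => coeff (i + 1) φ with hu_def
  have hu : constantCoeff u = 1 := constantCoeff_mk_coeff_succ hφ
  have hXu : X * u = φ := X_mul_mk_coeff_succ (X_dvd_of_X_sq_dvd_sub hφ)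
  have hs := hasSubst_of_X_dvd (X_dvd_of_X_sq_dvd_sub hφ)
  -- For `w = t^i` the form is `φ^(i-n-1) dφ`: exact for `i < n`, logarithmic with residue one for
  -- `i = n`, without a pole for `i > n`.
  have hpow : ∀ i : ℕ, coeff n (φ ^ i * binomialPow u (-((n : K) + 1)) * derivative K φ) =
      if i = n then 1 else 0 := by
    intro i
    have e : φ ^ i * binomialPow u (-((n : K) + 1)) * derivative K φ =
        X ^ i * (binomialPow u ((i : K) - ((n : K) + 1)) * derivative K φ) := by
      rw [sub_eq_add_neg, binomialPow_add hu, binomialPow_natCast hu]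
      nth_rw 1 [← hXu]
      ring
    rw [e, coeff_X_pow_mul']
    rcases lt_trichotomy i n with h | rfl | h
    · obtain ⟨q, rfl⟩ := Nat.exists_eq_add_of_lt h
      rw [if_pos (by omega), if_neg (by omega), show i + q + 1 - i = q + 1 by omega,
        ← coeff_binomialPow_neg_mul_derivative hφ (q := q + 1) (by omega)]
      congr 3
      push_cast; ring
    · rw [if_pos le_rfl, if_pos rfl, Nat.sub_self, coeff_zero_eq_constantCoeff_apply, map_mul,
        constantCoeff_binomialPow hu, constantCoeff_derivative hφ, one_mul]
    · rw [if_neg (by omega), if_neg (by omega)]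
  have hpoly : ∀ p : Polynomial K, coeff n ((p : K⟦X⟧).subst φ *
      binomialPow u (-((n : K) + 1)) * derivative K φ) = p.coeff n := by
    intro p
    induction p using Polynomial.induction_on' with
    | add p q hp hq =>
      rw [Polynomial.coe_add, subst_add hs, add_mul, add_mul, map_add, hp, hq, Polynomial.coeff_add]
    | monomial i a =>
      have e : PowerSeries.subst φ ((Polynomial.monomial i a : Polynomial K) : K⟦X⟧) =
          PowerSeries.C a * φ ^ i := by
        rw [subst_coe hs, Polynomial.aeval_monomial]; rfl
      rw [e, mul_assoc, mul_assoc, coeff_C_mul, ← mul_assoc, hpow, Polynomial.coeff_monomial]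
      simp
  have e := w.eq_X_pow_mul_shift_add_trunc (n + 1)
  have e2 := congrArg (PowerSeries.subst φ) e
  rw [subst_add hs, subst_mul hs, subst_pow hs, subst_X hs] at e2
  rw [e2, add_mul, add_mul, map_add, hpoly, coeff_trunc, if_pos n.lt_succ_self]
  rw [add_eq_right, mul_assoc, mul_assoc, ← hXu, mul_pow, mul_assoc, coeff_X_pow_mul',
    if_neg (by omega)]

/-- The coefficient of `t^n` in `(h / x_0)^α`; for `α = -1/λ` and `μ = (n + 1) λ` this is the
residue of the differential form attached to `h ∈ F_{λμ}`. -/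
def residue (n : ℕ) (α : K) (h : K⟦X⟧) : K :=
  coeff n (binomialPow (PowerSeries.C (coeff 0 h)⁻¹ * h) α)

theorem coeff_zero_substAct (lam mu : K) {φ : K⟦X⟧} (hφ : X ^ 2 ∣ φ - X) (h : K⟦X⟧) :
    coeff 0 (substAct lam mu φ h) = coeff 0 h := by
  rw [substAct, coeff_zero_eq_constantCoeff_apply, map_mul, map_mul,
    constantCoeff_subst_of_X_dvd (X_dvd_of_X_sq_dvd_sub hφ),
    constantCoeff_binomialPow (constantCoeff_mk_coeff_succ hφ),
    constantCoeff_binomialPow (constantCoeff_derivative hφ)]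
  simp

/-- Raising to the power `-1/λ` turns the exponents `μ` and `-λ` of the action into `-(n+1)` and
`1`, which is the transformation law of a differential form with a pole of order `n + 1`. -/
theorem residue_substAct {lam mu : K} (hl : lam ≠ 0) {n : ℕ} (hmu : mu = (n + 1 : ℕ) * lam)
    {φ : K⟦X⟧} (hφ : X ^ 2 ∣ φ - X) {h : K⟦X⟧} (h0 : coeff 0 h ≠ 0) :
    residue n (-1 / lam) (substAct lam mu φ h) = residue n (-1 / lam) h := by
  have hd := X_dvd_of_X_sq_dvd_sub hφ
  have hs := hasSubst_of_X_dvd hd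
  have hu := constantCoeff_mk_coeff_succ hφ
  have hφ' := constantCoeff_derivative hφ
  have h1 := constantCoeff_C_inv_mul h0
  rw [residue, residue, coeff_zero_substAct lam mu hφ,
    ← coeff_subst_mul_binomialPow_mul_derivative n hφ
      (binomialPow (PowerSeries.C (coeff 0 h)⁻¹ * h) (-1 / lam))]
  set v := PowerSeries.C (coeff 0 h)⁻¹ * h with hv
  have e : PowerSeries.C (coeff 0 h)⁻¹ * substAct lam mu φ h = substAct lam mu φ v := by
    rw [hv, substAct, substAct, subst_mul hs, subst_C]
    change _ = PowerSeries.C _ * _ * _ * _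
    ring
  have h2 : constantCoeff (v.subst φ) = 1 := by rw [constantCoeff_subst_of_X_dvd hd, h1]
  have e1 : mu * (-1 / lam) = -((n : K) + 1) := by rw [hmu]; push_cast; field_simp
  have e2 : -lam * (-1 / lam) = 1 := by field_simp
  rw [e, substAct, mul_binomialPow (by simp [h2, constantCoeff_binomialPow hu])
    (constantCoeff_binomialPow hφ' _), mul_binomialPow h2 (constantCoeff_binomialPow hu _),
    binomialPow_binomialPow hu, binomialPow_binomialPow hφ', e1, e2, binomialPow_one hφ',
    subst_binomialPow h1 hd]

theorem residue_sub_residue (n : ℕ) (hn : 1 ≤ n) (α : K) {h h' : K⟦X⟧} (h0 : coeff 0 h ≠ 0)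
    (hd : X ^ n ∣ h' - h) :
    residue n α h' - residue n α h = α * ((coeff 0 h)⁻¹ * coeff n (h' - h)) := by
  have h0' : coeff 0 h' = coeff 0 h := X_pow_dvd_sub_iff.1 hd 0 hn
  have hc : constantCoeff (PowerSeries.C (coeff 0 h)⁻¹ * h') = 1 := by
    rw [← h0']; exact constantCoeff_C_inv_mul (by rwa [h0'])
  rw [residue, residue, h0', ← map_sub, coeff_binomialPow_sub (constantCoeff_C_inv_mul h0) hc,
    ← mul_sub, coeff_C_mul]
  · rfl
  · rw [← mul_sub]; exact hd.mul_left _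

end Residue

/-! ### Criteria for two points to lie in one orbit. -/

section Orbits

variable {K : Type*} [Field K] [CharZero K]

theorem X_pow_dvd_sub_of_mem_orbit {m : ℕ} {lam mu : K} {h h' : K⟦X⟧}
    (hh : h' ∈ orbit m lam mu h) : X ^ (m + 1) ∣ h' - h := by
  obtain ⟨φ, hφ, rfl⟩ := mem_orbit_iff.1 hh
  nth_rw 2 [← substAct_X lam mu h]
  exact X_pow_dvd_substAct_sub lam mu h (by simp) ((pow_dvd_pow X (by omega)).trans hφ) hφ

/-- In each degree `n` beyond `m`, either the discrepancy can be corrected through the next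
coefficient of `φ`, or it is known to vanish already. -/
theorem mem_orbit_of_forall {m : ℕ} {lam mu : K} {h h' : K⟦X⟧} (h0 : coeff 0 h ≠ 0)
    (hd : X ^ (m + 1) ∣ h' - h)
    (hn : ∀ n, m + 1 ≤ n → mu ≠ (n + 1 : ℕ) * lam ∨ ∀ h'' ∈ orbit m lam mu h,
      X ^ n ∣ h'' - h' → coeff n (h'' - h') = 0) : h' ∈ orbit m lam mu h := by
  have two : ∀ φ : K⟦X⟧, X ^ (m + 1 + 1) ∣ φ - X → X ^ 2 ∣ φ - X :=
    fun φ hφ => (pow_dvd_pow X (by omega)).trans hφ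
  have hstep : ∀ n φ (a : K), m + 1 ≤ n → X ^ (m + 1 + 1) ∣ φ - X →
      X ^ (m + 1 + 1) ∣ φ + C a * X ^ (n + 1) - X := by
    intro n φ a hn hφ
    rw [add_sub_right_comm]
    exact dvd_add hφ ((pow_dvd_pow X (by omega)).mul_left _)
  obtain ⟨φ, hφ, e⟩ := exists_eq_of_step (fun φ => substAct lam mu φ h) X h' (m + 1) 1
    (by rw [substAct_X, dvd_sub_comm]; exact hd)
    (fun n φ φ' _ hφ hφ' h1 => X_pow_dvd_substAct_sub lam mu h (two φ hφ) (two φ' hφ') h1)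
    (fun n φ hmn hφ h1 => by
      rcases hn n hmn with hne | hres
      · set b : K := (mu - (n + 1 : ℕ) * lam) * coeff 0 h with hb
        have hb0 : b ≠ 0 := mul_ne_zero (sub_ne_zero.2 hne) h0
        -- Adding `a t^(n+1)` to `φ` adds `b a` in degree `n`; this `a` cancels the discrepancy.
        refine ⟨-coeff n (substAct lam mu φ h - h') / b, ?_⟩
        set a := -coeff n (substAct lam mu φ h - h') / b with ha
        have hdiv : X ^ (n + 1) ∣ φ + C a * X ^ (n + 1) - φ := by simp
        have hφ' := two _ (hstep n φ a hmn hφ)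
        rw [X_pow_succ_dvd_iff]
        constructor
        · have := dvd_add (X_pow_dvd_substAct_sub lam mu h (two φ hφ) hφ' hdiv) h1
          rwa [sub_add_sub_cancel] at this
        · have := coeff_substAct_sub lam mu h (two φ hφ) hφ' (by omega) hdiv
          rw [← hb, add_sub_cancel_left, coeff_C_mul, coeff_X_pow_self, mul_one, ha,
            mul_div_cancel₀ _ hb0] at this
          rw [← sub_add_sub_cancel _ (substAct lam mu φ h), map_add, this, neg_add_cancel]
      · refine ⟨0, ?_⟩
        rw [map_zero, zero_mul, add_zero, X_pow_succ_dvd_iff]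
        exact ⟨h1, hres _ (mem_orbit_iff.2 ⟨φ, hφ, rfl⟩) h1⟩)
  exact mem_orbit_iff.2 ⟨φ, hφ, e.symm⟩

theorem mem_orbit_iff_of_nonresonant {m : ℕ} {lam mu : K}
    (hres : ∀ k : ℕ, 1 ≤ k → mu ≠ ((m + k + 1 : ℕ) : K) * lam) {h h' : K⟦X⟧}
    (h0 : coeff 0 h ≠ 0) : h' ∈ orbit m lam mu h ↔ X ^ (m + 1) ∣ h' - h := by
  refine ⟨X_pow_dvd_sub_of_mem_orbit, fun hd => mem_orbit_of_forall h0 hd fun n hn => Or.inl ?_⟩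
  obtain ⟨k, rfl⟩ := Nat.exists_eq_add_of_le hn
  have := hres (k + 1) (by omega)
  rwa [show m + (k + 1) = m + 1 + k by omega] at this

theorem mem_orbit_iff_of_resonant {m k : ℕ} {lam mu : K} (hl : lam ≠ 0) (hk : 1 ≤ k)
    (hmu : mu = ((m + k + 1 : ℕ) : K) * lam) {h h' : K⟦X⟧} (h0 : coeff 0 h ≠ 0) :
    h' ∈ orbit m lam mu h ↔ X ^ (m + 1) ∣ h' - h ∧
      residue (m + k) (-1 / lam) h' = residue (m + k) (-1 / lam) h := by
  constructor
  · refine fun hh => ⟨X_pow_dvd_sub_of_mem_orbit hh, ?_⟩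
    obtain ⟨φ, hφ, rfl⟩ := mem_orbit_iff.1 hh
    exact residue_substAct hl hmu ((pow_dvd_pow X (by omega)).trans hφ) h0
  · rintro ⟨hd, hr⟩
    refine mem_orbit_of_forall h0 hd fun n hn => ?_
    by_cases hnk : n = m + k
    -- In the resonant degree, equal residues force equal coefficients, because the slope `α / x_0`
    -- is nonzero.
    · right
      subst hnk
      intro h'' hh hd'
      obtain ⟨φ, hφ, rfl⟩ := mem_orbit_iff.1 hh
      have h1 := residue_substAct hl hmu ((pow_dvd_pow X (by omega)).trans hφ) h0
      have h0' : coeff 0 h' ≠ 0 := by rwa [X_pow_dvd_sub_iff.1 hd 0 (by omega)]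
      have h2 := residue_sub_residue (m + k) (hk.trans (Nat.le_add_left k m)) (-1 / lam) h0' hd'
      rw [h1, hr, sub_self] at h2
      rw [coeff_zero_eq_constantCoeff_apply] at h0'
      simpa [hl, h0'] using h2.symm
    · left
      rw [hmu]
      intro h
      have := mul_right_cancel₀ hl h
      have : m + k + 1 = n + 1 := by exact_mod_cast this
      omega

end Orbits

/-! ### The part of the generating series that depends on `x_0, …, x_m` only. -/

section Truncation

variable {K : Type*} [Field K]

theorem constantCoeff_genSeries : constantCoeff (genSeries K) = 1 := by
  rw [← coeff_zero_eq_constantCoeff_apply, genSeries, coeff_mk, if_pos rfl]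

theorem trunc_rescale_congr {m : ℕ} {h h' : K⟦X⟧} (hd : X ^ (m + 1) ∣ h' - h) :
    trunc (m + 1) (rescale (coeff 0 h') (PowerSeries.C (coeff 0 h')⁻¹ * h')) =
      trunc (m + 1) (rescale (coeff 0 h) (PowerSeries.C (coeff 0 h)⁻¹ * h)) := by
  have hc := X_pow_dvd_sub_iff.1 hd
  ext i
  simp only [coeff_trunc, coeff_rescale, coeff_C_mul]
  split_ifs with hi
  · rw [hc 0 (by omega), hc i hi]
  · rfl

end Truncation

/-! ### Comparison of the polynomials `P` with the residue. -/

section Invariant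

variable {K : Type*} [Field K] [CharZero K]

theorem constantCoeff_coe_trunc {R : Type*} [CommRing R] (m : ℕ) (u : R⟦X⟧) :
    constantCoeff (trunc (m + 1) u : R⟦X⟧) = constantCoeff u := by
  rw [← coeff_zero_eq_constantCoeff_apply, Polynomial.coeff_coe, coeff_trunc,
    if_pos m.succ_pos, coeff_zero_eq_constantCoeff_apply]

theorem map_coe_trunc {R S : Type*} [CommRing R] [CommRing S] (f : R →+* S) (m : ℕ) (u : R⟦X⟧) :
    PowerSeries.map f (trunc m u : R⟦X⟧) = (trunc m (PowerSeries.map f u) : S⟦X⟧) := by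
  ext i
  simp only [coeff_map, Polynomial.coeff_coe, coeff_trunc]
  split_ifs <;> simp

/-- The division defining `P` is exact: for `i > m` the term `x_i x_0^(i-1)` vanishes modulo
`x_0^m`, so there the generating series equals its truncation, and so do their powers. -/
theorem X_zero_pow_mul_P (m k : ℕ) (α : K) :
    MvPolynomial.X 0 ^ m * P m k α = coeff (m + k) (binomialPow (genSeries K) α -
      binomialPow (trunc (m + 1) (genSeries K) : (MvPolynomial ℕ K)⟦X⟧) α) := by
  set D := coeff (m + k) (binomialPow (genSeries K) α -
      binomialPow (trunc (m + 1) (genSeries K) : (MvPolynomial ℕ K)⟦X⟧) α) with hD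
  have hdvd : MvPolynomial.X 0 ^ m ∣ D := by
    rw [← Ideal.mem_span_singleton]
    set I : Ideal (MvPolynomial ℕ K) := Ideal.span {MvPolynomial.X 0 ^ m} with hI
    have hc := constantCoeff_genSeries (K := K)
    have e : PowerSeries.map (Ideal.Quotient.mkₐ K I : MvPolynomial ℕ K →+* MvPolynomial ℕ K ⧸ I) (genSeries K) =
        PowerSeries.map (Ideal.Quotient.mkₐ K I : MvPolynomial ℕ K →+* MvPolynomial ℕ K ⧸ I)
          (trunc (m + 1) (genSeries K) : (MvPolynomial ℕ K)⟦X⟧) := by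
      ext i
      rw [coeff_map, coeff_map, Polynomial.coeff_coe, coeff_trunc]
      split_ifs with hi
      · rfl
      · rw [map_zero, genSeries, coeff_mk, if_neg (by omega)]
        refine Ideal.Quotient.eq_zero_iff_mem.2 (Ideal.mem_span_singleton.2 ?_)
        exact (pow_dvd_pow _ (by omega)).mul_left _
    have h1 := map_binomialPow (Ideal.Quotient.mkₐ K I) hc α
    have h2 := map_binomialPow (Ideal.Quotient.mkₐ K I)
      ((constantCoeff_coe_trunc m (genSeries K)).trans hc) α
    rw [e, ← h2, ← sub_eq_zero, ← map_sub] at h1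
    have h3 := congrArg (coeff (m + k)) h1
    rw [coeff_map, map_zero] at h3
    exact Ideal.Quotient.eq_zero_iff_mem.1 h3
  obtain ⟨q, hq⟩ := hdvd
  have hP : P m k α = MvPolynomial.divMonomial D (Finsupp.single 0 m) := rfl
  rw [hP, hq, MvPolynomial.X_pow_eq_monomial, MvPolynomial.divMonomial_monomial_mul]

/-- At `h` the generating series becomes `h / x_0` with `t` replaced by `x_0 z`, which multiplies
the coefficient of degree `m + k` by `x_0^(m+k)`. The subtracted term depends on `x_0, …, x_m` only.
-/
theorem evalAt_P (m k : ℕ) (α : K) {h : K⟦X⟧} (h0 : coeff 0 h ≠ 0) :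
    coeff 0 h ^ m * evalAt h (P m k α) = coeff 0 h ^ (m + k) * residue (m + k) α h -
      coeff (m + k) (binomialPow (trunc (m + 1)
        (rescale (coeff 0 h) (PowerSeries.C (coeff 0 h)⁻¹ * h)) : K⟦X⟧) α) := by
  set ev : MvPolynomial ℕ K →ₐ[K] K := MvPolynomial.aeval fun i => coeff i h with hev
  have hE : ∀ p, evalAt h p = ev p := fun p => by
    rw [evalAt, hev, ← MvPolynomial.coe_aeval_eq_eval]; rfl
  have hgen : PowerSeries.map (ev : MvPolynomial ℕ K →+* K) (genSeries K) =
      rescale (coeff 0 h) (PowerSeries.C (coeff 0 h)⁻¹ * h) := by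
    ext i
    rw [coeff_map, genSeries, coeff_mk, coeff_rescale, coeff_C_mul]
    rcases i with _ | i
    · simp only [if_true, map_one, pow_zero, one_mul]
      exact (inv_mul_cancel₀ h0).symm
    · simp only [Nat.succ_ne_zero, if_false, Nat.add_sub_cancel, RingHom.coe_coe, map_mul, map_pow,
        hev, MvPolynomial.aeval_X]
      field_simp
      ring
  have hc := constantCoeff_genSeries (K := K)
  have h1 := map_binomialPow ev hc α
  have h2 := map_binomialPow ev ((constantCoeff_coe_trunc m (genSeries K)).trans hc) α
  have h3 := congrArg ev (X_zero_pow_mul_P m k α)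
  rw [hgen, ← rescale_binomialPow (constantCoeff_C_inv_mul h0)] at h1
  rw [map_coe_trunc, hgen] at h2
  have h4 := congrArg (coeff (m + k)) h1
  have h5 := congrArg (coeff (m + k)) h2
  rw [coeff_map, coeff_rescale] at h4
  rw [coeff_map] at h5
  rw [map_mul, map_pow, map_sub, map_sub] at h3
  rw [hE, residue, ← h4, ← h5, RingHom.coe_coe, ← h3, hev, MvPolynomial.aeval_X]

theorem evalAt_P_eq_iff {m k : ℕ} {α : K} {h h' : K⟦X⟧} (h0 : coeff 0 h ≠ 0)
    (hd : X ^ (m + 1) ∣ h' - h) :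
    evalAt h' (P m k α) = evalAt h (P m k α) ↔ residue (m + k) α h' = residue (m + k) α h := by
  have h0' : coeff 0 h' = coeff 0 h := X_pow_dvd_sub_iff.1 hd 0 (by omega)
  have e1 := evalAt_P m k α h0
  have e2 := evalAt_P m k α (h := h') (by rwa [h0'])
  rw [trunc_rescale_congr hd, h0'] at e2
  rw [← mul_right_inj' (pow_ne_zero m h0), e1, e2, sub_left_inj,
    mul_right_inj' (pow_ne_zero _ h0)]

theorem exists_residue_eq {n : ℕ} (hn : 1 ≤ n) {α : K} (hα : α ≠ 0) {h : K⟦X⟧}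
    (h0 : coeff 0 h ≠ 0) (r : K) : ∃ h', X ^ n ∣ h' - h ∧ residue n α h' = r := by
  refine ⟨h + PowerSeries.C ((r - residue n α h) * coeff 0 h / α) * X ^ n, by simp, ?_⟩
  have := residue_sub_residue n hn α (h' := h +
    PowerSeries.C ((r - residue n α h) * coeff 0 h / α) * X ^ n) h0 (by simp)
  rw [sub_eq_iff_eq_add] at this
  rw [this, add_sub_cancel_left, coeff_C_mul, coeff_X_pow_self]
  field_simp
  ring

theorem exists_evalAt_P_eq {m k : ℕ} (hk : 1 ≤ k) {α : K} (hα : α ≠ 0) {h : K⟦X⟧}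
    (h0 : coeff 0 h ≠ 0) (c : K) :
    ∃ h', X ^ (m + 1) ∣ h' - h ∧ evalAt h' (P m k α) = c := by
  obtain ⟨h', hd, hr⟩ := exists_residue_eq (n := m + k) (by omega) hα h0
    ((coeff 0 h ^ m * c + coeff (m + k) (binomialPow (trunc (m + 1)
        (rescale (coeff 0 h) (PowerSeries.C (coeff 0 h)⁻¹ * h)) : K⟦X⟧) α)) /
          coeff 0 h ^ (m + k))
  have hd' : X ^ (m + 1) ∣ h' - h := (pow_dvd_pow X (by omega)).trans hd
  refine ⟨h', hd', ?_⟩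
  have h0' : coeff 0 h' = coeff 0 h := X_pow_dvd_sub_iff.1 hd' 0 (by omega)
  have e2 := evalAt_P m k α (h := h') (by rwa [h0'])
  rw [trunc_rescale_congr hd', h0', hr, mul_div_cancel₀ _ (pow_ne_zero _ h0),
    add_sub_cancel_right] at e2
  exact mul_left_cancel₀ (pow_ne_zero m h0) e2

end Invariant

/-! ### Parametrization of the orbits in general position. -/

section Parametrization

variable {K : Type*} [Field K] [CharZero K]

theorem isGeneralOrbit_iff {m : ℕ} {lam mu : K} (hne : ¬(lam = 0 ∧ mu = 0)) {O : Set K⟦X⟧} :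
    IsGeneralOrbit m lam mu O ↔ ∃ h, coeff 0 h ≠ 0 ∧ O = orbit m lam mu h := by
  simp [IsGeneralOrbit, InGeneralPosition, hne]

theorem bijOn_coordPlane {m : ℕ} {lam mu : K}
    (hres : ∀ k : ℕ, 1 ≤ k → mu ≠ ((m + k + 1 : ℕ) : K) * lam) :
    Set.BijOn (coordPlane m) {c : Fin (m + 1) → K | c 0 ≠ 0} {O | IsGeneralOrbit m lam mu O} := by
  have hne : ¬(lam = 0 ∧ mu = 0) := by
    rintro ⟨rfl, rfl⟩; exact hres 1 le_rfl (by simp)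
  have key : ∀ h : K⟦X⟧, coeff 0 h ≠ 0 →
      orbit m lam mu h = coordPlane m fun i => coeff (i : ℕ) h := by
    intro h h0
    ext h'
    rw [mem_orbit_iff_of_nonresonant hres h0, X_pow_dvd_sub_iff, coordPlane, Set.mem_ofPred_eq,
      Fin.forall_iff]
  have hex : ∀ c : Fin (m + 1) → K, ∃ h : K⟦X⟧, (fun i : Fin (m + 1) => coeff (i : ℕ) h) = c :=
    fun c => ⟨PowerSeries.mk fun i => if hi : i < m + 1 then c ⟨i, hi⟩ else 0, by
      ext i; rw [coeff_mk, dif_pos i.2]⟩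
  refine ⟨?_, ?_, ?_⟩
  · intro c hc
    obtain ⟨h, rfl⟩ := hex c
    exact (isGeneralOrbit_iff hne).2 ⟨h, hc, (key h hc).symm⟩
  · intro c _ c' _ e
    obtain ⟨h, rfl⟩ := hex c
    have : h ∈ coordPlane m c' := by rw [← e]; exact fun i => rfl
    exact funext this
  · intro O hO
    obtain ⟨h, h0, rfl⟩ := (isGeneralOrbit_iff hne).1 hO
    exact ⟨_, h0, (key h h0).symm⟩

/-- A function `val` that separates the orbits in general position with the same `x_0, …, x_m`
provides, together with these coordinates, a parametrization of them. -/
theorem bijOn_of_separating {m k : ℕ} {lam mu : K} (hl : lam ≠ 0) (hk : 1 ≤ k)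
    (hmu : mu = ((m + k + 1 : ℕ) : K) * lam) (val : K⟦X⟧ → K)
    (hval : ∀ h h', coeff 0 h ≠ 0 → X ^ (m + 1) ∣ h' - h →
      (val h' = val h ↔ residue (m + k) (-1 / lam) h' = residue (m + k) (-1 / lam) h))
    (hsurj : ∀ h c, coeff 0 h ≠ 0 → ∃ h', X ^ (m + 1) ∣ h' - h ∧ val h' = c) :
    Set.BijOn (fun c : Fin (m + 2) → K => {h : K⟦X⟧ |
      (∀ i : Fin (m + 1), coeff (i : ℕ) h = c i.castSucc) ∧ val h = c (Fin.last (m + 1))})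
      {c | c 0 ≠ 0} {O | IsGeneralOrbit m lam mu O} := by
  have hne : ¬(lam = 0 ∧ mu = 0) := fun h => hl h.1
  have key : ∀ (h : K⟦X⟧) (c : Fin (m + 2) → K), coeff 0 h ≠ 0 →
      (∀ i : Fin (m + 1), coeff (i : ℕ) h = c i.castSucc) → val h = c (Fin.last (m + 1)) →
      orbit m lam mu h = {h : K⟦X⟧ |
      (∀ i : Fin (m + 1), coeff (i : ℕ) h = c i.castSucc) ∧ val h = c (Fin.last (m + 1))} := by
    intro h c h0 hc hv
    ext h'
    rw [mem_orbit_iff_of_resonant hl hk hmu h0, Set.mem_ofPred_eq, ← hv]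
    simp only [← hc]
    have : X ^ (m + 1) ∣ h' - h ↔ ∀ i : Fin (m + 1), coeff (i : ℕ) h' = coeff (i : ℕ) h := by
      rw [X_pow_dvd_sub_iff, Fin.forall_iff]
    rw [← this]
    exact and_congr_right fun hd => (hval h h' h0 hd).symm
  have hex : ∀ c : Fin (m + 2) → K, c 0 ≠ 0 → ∃ h : K⟦X⟧, coeff 0 h ≠ 0 ∧
      (∀ i : Fin (m + 1), coeff (i : ℕ) h = c i.castSucc) ∧ val h = c (Fin.last (m + 1)) := by
    intro c hc
    set h₁ : K⟦X⟧ := PowerSeries.mk fun i => if hi : i < m + 2 then c ⟨i, hi⟩ else 0 with hh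
    have h1 : ∀ i : Fin (m + 1), coeff (i : ℕ) h₁ = c i.castSucc := by
      intro i
      rw [hh, coeff_mk, dif_pos (show (i : ℕ) < m + 2 by omega)]
      rfl
    have h1' : coeff 0 h₁ = c 0 := h1 0
    obtain ⟨h, hd, hv⟩ := hsurj h₁ (c (Fin.last (m + 1))) (by rwa [h1'])
    rw [X_pow_dvd_sub_iff] at hd
    exact ⟨h, by rwa [hd 0 (by omega), h1'], fun i => (hd i i.2).trans (h1 i), hv⟩
  refine ⟨?_, ?_, ?_⟩
  · intro c hc
    obtain ⟨h, h0, h1, h2⟩ := hex c hc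
    exact (isGeneralOrbit_iff hne).2 ⟨h, h0, (key h c h0 h1 h2).symm⟩
  · intro c hc c' _ e
    obtain ⟨h, h0, h1, h2⟩ := hex c hc
    have : (∀ i : Fin (m + 1), coeff (i : ℕ) h = c' i.castSucc) ∧
        val h = c' (Fin.last (m + 1)) := by
      have h3 := Set.ext_iff.1 e h
      exact h3.1 ⟨h1, h2⟩
    ext i
    induction i using Fin.lastCases with
    | last => rw [← h2, this.2]
    | cast i => rw [← h1, this.1]
  · intro O hO
    obtain ⟨h, h0, rfl⟩ := (isGeneralOrbit_iff hne).1 hO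
    refine ⟨Fin.snoc (fun i : Fin (m + 1) => coeff (i : ℕ) h) (val h), ?_,
      (key h _ h0 (by simp) (by simp)).symm⟩
    have : (Fin.snoc (fun i : Fin (m + 1) => coeff (i : ℕ) h) (val h) : Fin (m + 2) → K)
        (Fin.castSucc 0) = coeff 0 h := by rw [Fin.snoc_castSucc]; rfl
    rw [Set.mem_ofPred_eq, ← Fin.castSucc_zero, this]
    exact h0

theorem bijOn_resonantVariety {m k : ℕ} {lam mu : K} (hl : lam ≠ 0) (hk : 1 ≤ k)
    (hmu : mu = ((m + k + 1 : ℕ) : K) * lam) :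
    Set.BijOn (resonantVariety m k (-1 / lam)) {c : Fin (m + 2) → K | c 0 ≠ 0}
      {O | IsGeneralOrbit m lam mu O} :=
  bijOn_of_separating hl hk hmu (fun h => evalAt h (P m k (-1 / lam)))
    (fun _ _ h0 hd => evalAt_P_eq_iff h0 hd)
    (fun _ c h0 => exists_evalAt_P_eq hk (div_ne_zero (by simp) hl) h0 c)

/-- On an orbit `x_0` is a nonzero constant, so dividing by a power of it only rescales the last
parameter. -/
theorem bijOn_resonantVarietyDiv {m k : ℕ} (n : ℕ) {lam mu : K} (hl : lam ≠ 0) (hk : 1 ≤ k)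
    (hmu : mu = ((m + k + 1 : ℕ) : K) * lam) :
    Set.BijOn (resonantVarietyDiv m k n (-1 / lam)) {c : Fin (m + 2) → K | c 0 ≠ 0}
      {O | IsGeneralOrbit m lam mu O} := by
  refine bijOn_of_separating hl hk hmu
    (fun h => evalAt h (P m k (-1 / lam)) / coeff 0 h ^ ((k : ℤ) - (n : ℤ))) ?_ ?_
  · intro h h' h0 hd
    have h0' : coeff 0 h' = coeff 0 h := X_pow_dvd_sub_iff.1 hd 0 (by omega)
    rw [h0', div_left_inj' (zpow_ne_zero _ h0), evalAt_P_eq_iff h0 hd]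
  · intro h c h0
    obtain ⟨h', hd, hv⟩ := exists_evalAt_P_eq (m := m) hk
      (div_ne_zero (by simp) hl : (-1 / lam) ≠ 0) h0 (c * coeff 0 h ^ ((k : ℤ) - (n : ℤ)))
    have h0' : coeff 0 h' = coeff 0 h := X_pow_dvd_sub_iff.1 hd 0 (by omega)
    exact ⟨h', hd, by rw [hv, h0', mul_div_cancel_right₀ _ (zpow_ne_zero _ h0)]⟩

theorem isAffinePlaneOfCodim_of_nonresonant {m : ℕ} {lam mu : K}
    (hres : ∀ k : ℕ, 1 ≤ k → mu ≠ ((m + k + 1 : ℕ) : K) * lam) {h : K⟦X⟧}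
    (h0 : coeff 0 h ≠ 0) : IsAffinePlaneOfCodim (orbit m lam mu h) (m + 1) := by
  set L : K⟦X⟧ →ₗ[K] (Fin (m + 1) → K) := LinearMap.pi fun i => coeff (i : ℕ) with hL
  refine ⟨AffineSubspace.mk' h (LinearMap.ker L), ?_, ⟨h, mem_orbit_self m lam mu h⟩, ?_⟩
  · ext h'
    rw [mem_orbit_iff_of_nonresonant hres h0, SetLike.mem_coe, AffineSubspace.mem_mk',
      LinearMap.mem_ker, vsub_eq_sub, X_pow_dvd_iff, funext_iff, Fin.forall_iff]
    rfl
  · have hs : Function.Surjective L := fun c =>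
      ⟨PowerSeries.mk fun i => if hi : i < m + 1 then c ⟨i, hi⟩ else 0, by
        ext i
        rw [hL, LinearMap.pi_apply, coeff_mk, dif_pos i.2]⟩
    rw [AffineSubspace.direction_mk', (L.quotKerEquivOfSurjective hs).finrank_eq]
    simp

end Parametrization

/-! ### Resonant orbits as irreducible varieties. -/

section Variety

/-- A surjective comorphism makes the image a closed copy of affine `d`-space. As `K` is infinite,
the vanishing ideal is the kernel of the comorphism, so the coordinate ring is a polynomial ring in
`d` variables. -/
theorem isPrime_vanishingIdeal_range_and_dimension {K : Type*} [Field K] [CharZero K]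
    {N d : ℕ} (ψ : Fin N → MvPolynomial (Fin d) K)
    (hψ : Function.Surjective (MvPolynomial.aeval ψ : MvPolynomial (Fin N) K →ₐ[K] _))
    {V : Set (Fin N → K)}
    (hV : V = Set.range fun (y : Fin d → K) i => MvPolynomial.eval y (ψ i)) :
    (∃ I : Ideal (MvPolynomial (Fin N) K), V = MvPolynomial.zeroLocus K I) ∧
    (MvPolynomial.vanishingIdeal K V).IsPrime ∧
    ringKrullDim (MvPolynomial (Fin N) K ⧸ MvPolynomial.vanishingIdeal K V) = d := by
  have hcomp : ∀ (y : Fin d → K) (p : MvPolynomial (Fin N) K),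
      MvPolynomial.aeval (fun i => MvPolynomial.eval y (ψ i)) p =
        MvPolynomial.eval y (MvPolynomial.aeval ψ p) := by
    intro y p
    have := DFunLike.congr_fun (MvPolynomial.comp_aeval ψ (MvPolynomial.aeval y : _ →ₐ[K] K)) p
    simpa [MvPolynomial.coe_aeval_eq_eval] using this.symm
  have hI : MvPolynomial.vanishingIdeal K V =
      RingHom.ker (MvPolynomial.aeval ψ : MvPolynomial (Fin N) K →ₐ[K] _) := by
    ext p
    rw [MvPolynomial.mem_vanishingIdeal_iff, RingHom.mem_ker, hV, Set.forall_mem_range]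
    simp only [hcomp]
    refine ⟨fun h => MvPolynomial.funext fun y => by rw [h y, map_zero], fun h y => ?_⟩
    rw [h, map_zero]
  refine ⟨⟨MvPolynomial.vanishingIdeal K V, ?_⟩, ?_, ?_⟩
  · apply Set.Subset.antisymm
    · intro v hv p hp
      exact hp v hv
    · intro v hv
      rw [hI] at hv
      -- Lifts of the variables define a retraction; a zero `v` of the kernel is the image of the
      -- point with coordinates `s j` evaluated at `v`.
      choose s hs using fun j => hψ (MvPolynomial.X j)
      rw [hV]
      refine ⟨fun j => MvPolynomial.aeval v (s j), funext fun i => ?_⟩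
      have hker : MvPolynomial.aeval s (ψ i) - MvPolynomial.X i ∈
          RingHom.ker (MvPolynomial.aeval ψ : MvPolynomial (Fin N) K →ₐ[K] _) := by
        have := DFunLike.congr_fun (MvPolynomial.comp_aeval s
          (MvPolynomial.aeval ψ : MvPolynomial (Fin N) K →ₐ[K] _)) (ψ i)
        simp only [hs] at this
        rw [RingHom.mem_ker, map_sub, MvPolynomial.aeval_X, sub_eq_zero]
        simpa using this
      have h1 := hv _ hker
      rw [map_sub, MvPolynomial.aeval_X, sub_eq_zero] at h1
      rw [← h1]
      have := DFunLike.congr_fun (MvPolynomial.comp_aeval s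
          (MvPolynomial.aeval v : MvPolynomial (Fin N) K →ₐ[K] K)) (ψ i)
      simpa [MvPolynomial.coe_aeval_eq_eval] using this.symm
  · rw [hI]
    exact RingHom.ker_isPrime _
  · rw [hI, ringKrullDim_eq_of_ringEquiv
      (Ideal.quotientKerAlgEquivOfSurjective hψ).toRingEquiv,
      MvPolynomial.ringKrullDim_of_isNoetherianRing]
    simp

/-- With `k = l + 1`, the coordinates `x_{m+1}, …, x_{m+l}` are free and the residue equation gives
`x_{m+l+1}` as a polynomial in them. The orbit is thus cut out by a graph of dimension `l` in the
first `m + l + 2` coordinates. -/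
theorem isAffineVarietyOfCodim_of_resonant {K : Type*} [Field K] [CharZero K]
    {m k : ℕ} {lam mu : K} (hl : lam ≠ 0) (hk : 1 ≤ k)
    (hmu : mu = ((m + k + 1 : ℕ) : K) * lam) {h : K⟦X⟧} (h0 : coeff 0 h ≠ 0) :
    IsAffineVarietyOfCodim (orbit m lam mu h) (m + 2) := by
  obtain ⟨l, rfl⟩ := Nat.exists_eq_add_of_le' hk
  set α : K := -1 / lam with hα
  have hα0 : α ≠ 0 := div_ne_zero (by simp) hl
  set r := residue (m + (l + 1)) α h with hr
  -- the generic point with the given first coordinates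
  set H : (MvPolynomial (Fin l) K)⟦X⟧ := PowerSeries.mk fun i =>
    if i < m + 1 then MvPolynomial.C (coeff i h)
    else if hi : i - (m + 1) < l then MvPolynomial.X ⟨i - (m + 1), hi⟩ else 0 with hH
  set U : (MvPolynomial (Fin l) K)⟦X⟧ :=
    PowerSeries.C (MvPolynomial.C (coeff 0 h)⁻¹) * H with hU
  have hUc : constantCoeff U = 1 := by
    rw [hU, map_mul, constantCoeff_C, ← coeff_zero_eq_constantCoeff_apply, hH, coeff_mk,
      if_pos (by omega), ← map_mul, inv_mul_cancel₀ h0, map_one]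
  -- The generic point `H` has `x_{m+l+1} = 0`. Raising this coordinate to `q` adds `α q / x_0` to
  -- the residue, which makes it `r`.
  set q : MvPolynomial (Fin l) K := MvPolynomial.C (coeff 0 h / α) *
    (MvPolynomial.C r - coeff (m + (l + 1)) (binomialPow U α)) with hq
  set ψ : Fin (m + l + 2) → MvPolynomial (Fin l) K := fun i =>
    if (i : ℕ) < m + l + 1 then coeff (i : ℕ) H else q with hψ
  have hsurj : Function.Surjective (MvPolynomial.aeval ψ :
      MvPolynomial (Fin (m + l + 2)) K →ₐ[K] MvPolynomial (Fin l) K) := by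
    rw [← AlgHom.range_eq_top, eq_top_iff, ← MvPolynomial.adjoin_range_X, Algebra.adjoin_le_iff]
    rintro _ ⟨j, rfl⟩
    refine ⟨MvPolynomial.X ⟨m + 1 + j, by omega⟩, ?_⟩
    change MvPolynomial.aeval ψ _ = _
    rw [MvPolynomial.aeval_X, hψ]
    simp only [hH, coeff_mk]
    rw [if_pos (by omega), if_neg (by omega), dif_pos (by omega)]
    congr 1
    ext
    simp
  have hres : ∀ (y : Fin l → K) (g : K⟦X⟧),
      (∀ i < m + l + 1, coeff i g = MvPolynomial.eval y (coeff i H)) →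
      (residue (m + (l + 1)) α g = r ↔ coeff (m + l + 1) g = MvPolynomial.eval y q) := by
    intro y g hg
    set g₀ : K⟦X⟧ := PowerSeries.map (MvPolynomial.eval y) H with hg₀
    have hc0 : coeff 0 g₀ = coeff 0 h := by
      rw [hg₀, coeff_map, hH, coeff_mk, if_pos (by omega), MvPolynomial.eval_C]
    have hcn : coeff (m + (l + 1)) g₀ = 0 := by
      rw [hg₀, coeff_map, hH, coeff_mk, if_neg (by omega), dif_neg (by omega), map_zero]
    have hd : X ^ (m + (l + 1)) ∣ g - g₀ := by
      rw [X_pow_dvd_sub_iff]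
      intro i hi
      rw [hg i (by omega), hg₀, coeff_map]
    have hr0 : residue (m + (l + 1)) α g₀ =
        MvPolynomial.eval y (coeff (m + (l + 1)) (binomialPow U α)) := by
      have hm := map_binomialPow (MvPolynomial.aeval y : MvPolynomial (Fin l) K →ₐ[K] K) hUc α
      have hco : ((MvPolynomial.aeval y : MvPolynomial (Fin l) K →ₐ[K] K) :
          MvPolynomial (Fin l) K →+* K) = MvPolynomial.eval y := by
        ext <;> simp
      rw [hco] at hm
      rw [residue, hc0, ← coeff_map, hm, hU, map_mul, map_C, MvPolynomial.eval_C]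
    have h1 := residue_sub_residue (m + (l + 1)) (by omega) α (by rwa [hc0]) hd
    rw [map_sub, hcn, sub_zero, hc0, hr0, sub_eq_iff_eq_add] at h1
    rw [h1, hq, map_mul, map_sub, MvPolynomial.eval_C, MvPolynomial.eval_C, ← eq_sub_iff_add_eq,
      ← add_assoc m l 1]
    constructor
    · intro e; rw [← e]; field_simp
    · intro e; rw [e]; field_simp
  obtain ⟨h1, h2, h3⟩ := isPrime_vanishingIdeal_range_and_dimension ψ hsurj rfl
  refine ⟨m + l + 2, _, ?_, h1, h2, ?_⟩
  · ext g
    rw [mem_orbit_iff_of_resonant hl hk hmu h0, Set.mem_ofPred_eq, Set.mem_range,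
      X_pow_dvd_sub_iff]
    constructor
    · rintro ⟨hc, hrg⟩
      set y : Fin l → K := fun j => coeff (m + 1 + j) g with hy
      have hg : ∀ i < m + l + 1, coeff i g = MvPolynomial.eval y (coeff i H) := by
        intro i hi
        rw [hH, coeff_mk]
        split_ifs with h1 h2
        · rw [MvPolynomial.eval_C, hc i h1]
        · rw [MvPolynomial.eval_X, hy]
          congr 2
          simp only
          omega
        · omega
      refine ⟨y, funext fun i => ?_⟩
      simp only [hψ, firstCoords]
      split_ifs with hi
      · rw [hg i hi]
      · rw [← (hres y g hg).1 hrg, show (i : ℕ) = m + l + 1 by omega]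
    · rintro ⟨y, hy⟩
      have hyi : ∀ i (hi : i < m + l + 2), MvPolynomial.eval y (ψ ⟨i, hi⟩) = coeff i g :=
        fun i hi => congrFun hy ⟨i, hi⟩
      have hg : ∀ i < m + l + 1, coeff i g = MvPolynomial.eval y (coeff i H) := by
        intro i hi
        rw [← hyi i (by omega)]
        simp only [hψ]
        rw [if_pos hi]
      refine ⟨fun i hi => ?_, (hres y g hg).2 ?_⟩
      · rw [hg i (by omega), hH, coeff_mk, if_pos hi, MvPolynomial.eval_C]
      · rw [← hyi (m + l + 1) (by omega)]
        simp only [hψ]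
        rw [if_neg (by omega)]
  · rw [h3]
    norm_cast
    omega

end Variety

/-! ### Orders of vanishing. -/

section Orders

variable {K : Type*} [Field K]

theorem exists_eq_X_pow_mul {h : K⟦X⟧} (hh : h ≠ 0) :
    ∃ (i : ℕ) (h' : K⟦X⟧), coeff 0 h' ≠ 0 ∧ h = X ^ i * h' := by
  obtain ⟨i, hi⟩ : ∃ i, ¬ X ^ i ∣ h := by
    by_contra! hc
    exact hh (eq_of_forall_X_pow_dvd_sub fun n => by rw [sub_zero]; exact hc n)
  induction i generalizing h with
  | zero => simp at hi
  | succ i ih =>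
    by_cases h0 : coeff 0 h = 0
    · rw [coeff_zero_eq_constantCoeff_apply, ← X_dvd_iff] at h0
      obtain ⟨r, rfl⟩ := h0
      have hr : r ≠ 0 := right_ne_zero_of_mul hh
      rw [pow_succ', mul_dvd_mul_iff_left X_ne_zero] at hi
      obtain ⟨j, h', h1, rfl⟩ := ih hr hi
      exact ⟨j + 1, h', h1, by ring⟩
    · exact ⟨0, h, h0, by simp⟩

theorem coeff_constFun_add {j l : ℕ} (hl : 1 ≤ l) (c : K) (h : K⟦X⟧) :
    X ^ j ∣ constFun j c + X ^ (l + j) * h ∧ coeff j (constFun j c + X ^ (l + j) * h) = c := by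
  refine ⟨dvd_add (dvd_mul_left _ _) ((pow_dvd_pow X (by omega)).mul_right _), ?_⟩
  rw [map_add, constFun, coeff_C_mul, coeff_X_pow_self, coeff_X_pow_mul', if_neg (by omega)]
  ring

end Orders

/-! ### Orbits under inclusions of spaces, and the exceptional orbits. -/

section Inclusions

variable {K : Type*} [Field K] [CharZero K]

theorem incl_orbit (m : ℕ) (lam mu : K) (i : ℕ) (h : K⟦X⟧) :
    incl i (orbit m lam (mu + i) h) = orbit m lam mu (X ^ i * h) := by
  ext h'
  simp only [incl, Set.mem_image, mem_orbit_iff]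
  constructor
  · rintro ⟨_, ⟨φ, hφ, rfl⟩, rfl⟩
    exact ⟨φ, hφ, (substAct_X_pow_mul lam mu i ((pow_dvd_pow X (by omega)).trans hφ) h).symm⟩
  · rintro ⟨φ, hφ, rfl⟩
    exact ⟨_, ⟨φ, hφ, rfl⟩,
      (substAct_X_pow_mul lam mu i ((pow_dvd_pow X (by omega)).trans hφ) h).symm⟩

theorem orbit_zero (m : ℕ) (lam mu : K) : orbit m lam mu 0 = {0} := by
  ext h'
  rw [Set.mem_singleton_iff]
  constructor
  · rintro ⟨g, _, rfl⟩
    rw [act, map_zero, zero_mul, zero_mul]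
  · rintro rfl
    exact mem_orbit_self m lam mu 0

/-- The action is additive and fixes the constant functions, so translation by `c` carries orbits to
orbits. -/
theorem constAdd_orbit (m j i : ℕ) (c : K) (h : K⟦X⟧) :
    constAdd j i c (orbit m 0 (i : K) h) =
      orbit m 0 (-(j : K)) (constFun j c + X ^ (i + j) * h) := by
  have e : (i : K) = -(j : K) + (i + j : ℕ) := by push_cast; ring
  rw [constAdd, e, incl_orbit]
  ext h'
  simp only [Set.mem_image, mem_orbit_iff]
  have hadd : ∀ φ : K⟦X⟧, X ^ (m + 2) ∣ φ - X → ∀ f, substAct 0 (-(j : K)) φ (constFun j c + f) =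
      constFun j c + substAct 0 (-(j : K)) φ f := by
    intro φ hφ f
    have h2 : X ^ 2 ∣ φ - X := (pow_dvd_pow X (by omega)).trans hφ
    rw [substAct_add _ _ h2, substAct_constFun j c h2]
  constructor
  · rintro ⟨_, ⟨φ, hφ, rfl⟩, rfl⟩
    exact ⟨φ, hφ, (hadd φ hφ _).symm⟩
  · rintro ⟨φ, hφ, rfl⟩
    exact ⟨_, ⟨φ, hφ, rfl⟩, (hadd φ hφ _).symm⟩

theorem orbit_constFun (m j : ℕ) (c : K) :
    orbit m 0 (-(j : K)) (constFun j c) = {constFun j c} := by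
  ext h'
  rw [Set.mem_singleton_iff, mem_orbit_iff]
  constructor
  · rintro ⟨φ, hφ, rfl⟩
    exact substAct_constFun j c ((pow_dvd_pow X (by omega)).trans hφ)
  · rintro rfl
    exact ⟨X, by simp, (substAct_X _ _ _).symm⟩

theorem exists_isGeneralOrbit_of_ne {m : ℕ} {lam mu : K} {i : ℕ} (hne : ¬(lam = 0 ∧ mu + i = 0))
    {h : K⟦X⟧} (h0 : coeff 0 h ≠ 0) :
    ∃ O', IsGeneralOrbit m lam (mu + i) O' ∧ orbit m lam mu (X ^ i * h) = incl i O' :=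
  ⟨_, (isGeneralOrbit_iff hne).2 ⟨h, h0, rfl⟩, (incl_orbit m lam mu i h).symm⟩

/-- The cases follow the order of vanishing `i`. Only `i = j` leads to `F_{00}`; there the constant
`c` is split off, and the remainder is either zero or in general position in some `F_{0,l+1}`. -/
theorem isOrbit_exceptional {m j : ℕ} {O : Set K⟦X⟧} (hO : IsOrbit m 0 (-(j : K)) O)
    (hne : O ≠ {0}) :
    (∃ (i : ℕ) (O' : Set K⟦X⟧), -(j : K) + i ≠ 0 ∧
      IsGeneralOrbit m 0 (-(j : K) + i) O' ∧ O = incl i O') ∨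
    (∃ c : K, c ≠ 0 ∧ ∃ i : ℕ, 1 ≤ i ∧ ∃ O', IsGeneralOrbit m 0 (i : K) O' ∧
      O = constAdd j i c O') ∨
    (∃ c : K, c ≠ 0 ∧ O = {constFun j c}) := by
  obtain ⟨h, rfl⟩ := hO
  have hh : h ≠ 0 := fun e => hne (by rw [e, orbit_zero])
  obtain ⟨i, h', h0, rfl⟩ := exists_eq_X_pow_mul hh
  by_cases hij : i = j
  · subst hij
    set c := coeff 0 h' with hc
    obtain ⟨r, hr⟩ : X ∣ h' - PowerSeries.C c := by rw [X_dvd_iff]; simp [hc]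
    have e : X ^ i * h' = constFun i c + X ^ (i + 1) * r := by
      rw [constFun]; linear_combination X ^ i * hr
    by_cases hr0 : r = 0
    · right; right
      refine ⟨c, h0, ?_⟩
      rw [e, hr0, mul_zero, add_zero, orbit_constFun]
    · right; left
      obtain ⟨l, s, hs, rfl⟩ := exists_eq_X_pow_mul hr0
      refine ⟨c, h0, l + 1, by omega, orbit m 0 ((l + 1 : ℕ) : K) s,
        (isGeneralOrbit_iff fun h => Nat.cast_ne_zero.2 l.succ_ne_zero h.2).2 ⟨s, hs, rfl⟩, ?_⟩
      rw [constAdd_orbit, e]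
      congr 2
      ring
  · left
    have hne' : -(j : K) + i ≠ 0 := by
      intro h
      rw [neg_add_eq_zero, Nat.cast_inj] at h
      exact hij h.symm
    obtain ⟨O', h1, h2⟩ := exists_isGeneralOrbit_of_ne (m := m) (lam := (0 : K))
      (fun h => hne' h.2) h0
    exact ⟨i, O', hne', h1, h2⟩

/-- An orbit in general position in `F_{0,i-j}` with `i ≠ j` contains no element of order `j` in
`F_{0,-j}`. -/
theorem not_coeff_of_mem_incl {m i j : ℕ} {O' : Set K⟦X⟧} (hij : -(j : K) + i ≠ 0)
    (hO' : IsGeneralOrbit m 0 (-(j : K) + i) O') {f : K⟦X⟧} (hf : f ∈ incl i O')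
    (hd : X ^ j ∣ f) : coeff j f = 0 := by
  obtain ⟨h, h0, rfl⟩ := (isGeneralOrbit_iff fun h => hij h.2).1 hO'
  obtain ⟨h', hh', rfl⟩ := hf
  have h0' : coeff 0 h' ≠ 0 := by
    rwa [X_pow_dvd_sub_iff.1 (X_pow_dvd_sub_of_mem_orbit hh') 0 (by omega)]
  change X ^ j ∣ X ^ i * h' at hd
  change coeff j (X ^ i * h') = 0
  rcases lt_trichotomy i j with h | rfl | h
  · have := X_pow_dvd_iff.1 hd i h
    rw [coeff_X_pow_mul', if_pos le_rfl, Nat.sub_self] at this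
    exact absurd this h0'
  · simp at hij
  · rw [coeff_X_pow_mul', if_neg (by omega)]

end Inclusions

end TensorFields

end

/-! ### Assembly of the theorem. -/

open TensorFields in
theorem theorem5 {K : Type*} [Field K] [CharZero K] (m : ℕ) (lam mu : K) :
    -- the non-resonant case
    ((∀ k : ℕ, 1 ≤ k → mu ≠ ((m + k + 1 : ℕ) : K) * lam) →
      Set.BijOn (TensorFields.coordPlane m) {c : Fin (m + 1) → K | c 0 ≠ 0}
        {O | TensorFields.IsGeneralOrbit m lam mu O} ∧
      ∀ O, TensorFields.IsGeneralOrbit m lam mu O →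
        TensorFields.IsAffinePlaneOfCodim O (m + 1)) ∧
    -- the resonant case
    (lam ≠ 0 → ∀ k : ℕ, 1 ≤ k → mu = ((m + k + 1 : ℕ) : K) * lam →
      ((∀ n : ℕ, 1 ≤ n → n < k → -1 / lam ≠ (n : K)) →
        Set.BijOn (TensorFields.resonantVariety m k (-1 / lam)) {c : Fin (m + 2) → K | c 0 ≠ 0}
          {O | TensorFields.IsGeneralOrbit m lam mu O}) ∧
      (∀ n : ℕ, 1 ≤ n → -1 / lam = (n : K) →
        Set.BijOn (TensorFields.resonantVarietyDiv m k n (-1 / lam))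
          {c : Fin (m + 2) → K | c 0 ≠ 0} {O | TensorFields.IsGeneralOrbit m lam mu O}) ∧
      ∀ O, TensorFields.IsGeneralOrbit m lam mu O →
        TensorFields.IsAffineVarietyOfCodim O (m + 2)) ∧
    -- orbits in general position are orbits in the larger spaces
    (∀ O, TensorFields.IsGeneralOrbit m lam mu O → ∀ i : ℕ,
      TensorFields.IsOrbit m lam (mu - (i : K)) (TensorFields.incl i O)) ∧
    -- every nonzero orbit is in general position in a smaller space, outside the exceptional case
    (¬(lam = 0 ∧ ∃ j : ℕ, mu = -(j : K)) →
      ∀ O, TensorFields.IsOrbit m lam mu O → O ≠ {0} →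
        ∃ (i : ℕ) (O' : Set (PowerSeries K)),
          TensorFields.IsGeneralOrbit m lam (mu + (i : K)) O' ∧ O = TensorFields.incl i O') ∧
    -- the exceptional case
    (∀ j : ℕ, lam = 0 → mu = -(j : K) →
      -- the sets `c + O` and the constants `c ≠ 0` are orbits
      (∀ c : K, c ≠ 0 → ∀ i : ℕ, 1 ≤ i → ∀ O, TensorFields.IsGeneralOrbit m 0 (i : K) O →
        TensorFields.IsOrbit m lam mu (TensorFields.constAdd j i c O)) ∧
      (∀ c : K, c ≠ 0 → TensorFields.IsOrbit m lam mu {TensorFields.constFun j c}) ∧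
      -- every nonzero orbit is in general position in some smaller space, or one of these
      (∀ O, TensorFields.IsOrbit m lam mu O → O ≠ {0} →
        (∃ (i : ℕ) (O' : Set (PowerSeries K)), mu + (i : K) ≠ 0 ∧
          TensorFields.IsGeneralOrbit m lam (mu + (i : K)) O' ∧ O = TensorFields.incl i O') ∨
        (∃ c : K, c ≠ 0 ∧ ∃ i : ℕ, 1 ≤ i ∧ ∃ O', TensorFields.IsGeneralOrbit m 0 (i : K) O' ∧
          O = TensorFields.constAdd j i c O') ∨
        (∃ c : K, c ≠ 0 ∧ O = {TensorFields.constFun j c})) ∧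
      -- these are genuine exceptions
      (∀ (i : ℕ) (O' : Set (PowerSeries K)), mu + (i : K) ≠ 0 →
        TensorFields.IsGeneralOrbit m lam (mu + (i : K)) O' →
        (∀ c : K, c ≠ 0 → ∀ l : ℕ, 1 ≤ l → ∀ O, TensorFields.IsGeneralOrbit m 0 (l : K) O →
          TensorFields.incl i O' ≠ TensorFields.constAdd j l c O) ∧
        (∀ c : K, c ≠ 0 → TensorFields.incl i O' ≠ {TensorFields.constFun j c}))) := by

  refine ⟨fun hres => ⟨bijOn_coordPlane hres, fun O hO => ?_⟩,
    fun hl k hk hmu => ⟨fun _ => bijOn_resonantVariety hl hk hmu,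
      fun n _ _ => bijOn_resonantVarietyDiv n hl hk hmu, fun O hO => ?_⟩,
    fun O hO i => ?_, fun hexc O hO hne => ?_, ?_⟩
  · obtain ⟨h, h0, rfl⟩ := (isGeneralOrbit_iff
      (by rintro ⟨rfl, rfl⟩; exact hres 1 le_rfl (by simp))).1 hO
    exact isAffinePlaneOfCodim_of_nonresonant hres h0
  · obtain ⟨h, h0, rfl⟩ := (isGeneralOrbit_iff fun h => hl h.1).1 hO
    exact isAffineVarietyOfCodim_of_resonant hl hk hmu h0
  · obtain ⟨h, -, rfl⟩ := hO
    refine ⟨PowerSeries.X ^ i * h, ?_⟩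
    rw [← incl_orbit, sub_add_cancel]
  · obtain ⟨h, rfl⟩ := hO
    have hh : h ≠ 0 := fun e => hne (by rw [e, orbit_zero])
    obtain ⟨i, h', h0, rfl⟩ := exists_eq_X_pow_mul hh
    exact ⟨i, exists_isGeneralOrbit_of_ne
      (fun h => hexc ⟨h.1, i, eq_neg_of_add_eq_zero_left h.2⟩) h0⟩
  · rintro j rfl rfl
    refine ⟨fun c _ i _ O hO => ?_, fun c _ => ⟨_, (orbit_constFun m j c).symm⟩,
      fun O hO hne => isOrbit_exceptional hO hne, fun i O' hij hO' => ⟨?_, ?_⟩⟩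
    · obtain ⟨h, -, rfl⟩ := hO
      exact ⟨_, constAdd_orbit m j i c h⟩
    · rintro c hc l hl O ⟨h, -, rfl⟩ e
      rw [constAdd_orbit] at e
      -- This point has order exactly `j` with leading coefficient `c ≠ 0`, which no point of `incl
      -- i O'` can have.
      have hmem := mem_orbit_self m 0 (-(j : K)) (constFun j c + PowerSeries.X ^ (l + j) * h)
      rw [← e] at hmem
      obtain ⟨h1, h2⟩ := coeff_constFun_add (j := j) hl c h
      exact hc (h2.symm.trans (not_coeff_of_mem_incl hij hO' hmem h1))
    · intro c hc e
      have hmem : constFun j c ∈ incl i O' := by rw [e]; rfl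
      obtain ⟨h1, h2⟩ := coeff_constFun_add (j := j) le_rfl c 0
      rw [mul_zero, add_zero] at h1 h2
      exact hc (h2.symm.trans (not_coeff_of_mem_incl hij hO' hmem h1))
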